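/- Let $X_1,\dots,X_n$ be i.i.d. real random variables with distribution function $F$. Suppose that $F$ is continuous with median $\theta_0$ (i.e. $\mathbb P(X_1\le\theta_0)\ge 1/2$ and $\mathbb P(X_1\ge\theta_0)\ge 1/2$), and that $$|F(\theta_0+h)-F(\theta_0)-Mh|\le C|h|^{1+\delta}\qquad\text{for all } |h|<\eta,$$ where $0<M,C,\delta,\eta<\infty$. Put $\zeta:=(M/2)\min\{\eta,(M/(2C))^{1/\delta}\}$. For $\alpha\in(0,1)$ let $z_{\alpha/2}$ be the $(1-\alpha/2)$-quantile of the standard normal distribution, let $c_{n,\alpha}$ be the smallest integer $x$ with $\mathbb P(Y_n\ge\lfloor n/2\rfloor-x)\ge 1-\alpha/2$, where $Y_n\sim\mathrm{Bin}(n,1/2)$, and let $\widehat{\mathrm{CI}}_{n,\alpha}$ be the set of all $\theta\in\mathbb R$ such that $$\sum_{i=1}^n\mathbf 1\{X_i\le\theta\}\ge\lfloor n/2\rfloor-c_{n,\alpha}\quad\text{and}\quad\sum_{i=1}^n\mathbf 1\{X_i\ge\theta\}\ge\lfloor n/2\rfloor-c_{n,\alpha}.$$ Then for every $n\ge 2$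 and $\alpha\in(0,1)$ with $n\ge\max\{\log_2(2/\alpha),\,49\log(2n/\alpha)/\zeta^2\}$, with probability at least $1-6n^{-2}$, the interval $\widehat{\mathrm{CI}}_{n,\alpha}$ is bounded and $$\left|\frac{n^{1/2}M}{z_{\alpha/2}}\mathrm{Width}(\widehat{\mathrm{CI}}_{n,\alpha})-1\right|\le\frac{1+14\log(n)/z_{\alpha/2}}{n^{1/4}}+\sqrt{\frac{\log(2/\alpha)}{8n}}+\frac{2C\,(14)^{1+\delta}(\log(2n/\alpha))^{(1+\delta)/2}}{z_{\alpha/2}M^{1+\delta}n^{\delta/2}}.$$ Moreover, for fixed $\alpha\in(0,1)$, $M$, $C$, $\delta$, the right-hand side is, as $n\to\infty$, of exact order $\log(n)\,n^{-1/4}+(\log n)^{(1+\delta)/2}n^{-\delta/2}$, i.e. it lies between two positive constant multiples of it for all large $n$. -/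

import Mathlib

open MeasureTheory ProbabilityTheory Filter Asymptotics

namespace MedianCI

/-- `θ` is a median of the law `ν`: `P(X ≤ θ) ≥ 1/2` and `P(X ≥ θ) ≥ 1/2` for `X ∼ ν`. -/
def IsMedian (ν : Measure ℝ) (θ : ℝ) : Prop :=
  1 / 2 ≤ ν.real (Set.Iic θ) ∧ 1 / 2 ≤ ν.real (Set.Ici θ)

/-- The upper `p`-quantile `z_p` of the standard normal law, i.e. `Φ(z_p) = 1 - p` for
`0 < p < 1`. -/
noncomputable def z (p : ℝ) : ℝ :=
  sInf {x : ℝ | 1 - p ≤ cdf (gaussianReal 0 1) x}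

/-- The probability `1/2`, as a point of the unit interval. -/
noncomputable def half : unitInterval := ⟨1 / 2, by norm_num, by norm_num⟩

/-- The smallest integer `x` with `P(Y ≥ ⌊n/2⌋ - x) ≥ 1 - α/2`, where `Y ∼ Bin(n, 1/2)`. -/
noncomputable def c (n : ℕ) (α : ℝ) : ℤ :=
  sInf {x : ℤ | 1 - α / 2 ≤
    (ProbabilityTheory.binomial n half).real {k : ℕ | ((n / 2 : ℕ) : ℤ) - x ≤ (k : ℤ)}}

/-- The points `θ` with `∑ 1{x_i ≤ θ} ≥ ⌊n/2⌋ - c_{n,α}`. -/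
noncomputable def CI₁ {n : ℕ} (α : ℝ) (x : Fin n → ℝ) : Set ℝ :=
  {θ | ((n / 2 : ℕ) : ℤ) - c n α ≤ (Nat.card {i : Fin n // x i ≤ θ} : ℤ)}

/-- The points `θ` with `∑ 1{x_i ≥ θ} ≥ ⌊n/2⌋ - c_{n,α}`. -/
noncomputable def CI₂ {n : ℕ} (α : ℝ) (x : Fin n → ℝ) : Set ℝ :=
  {θ | ((n / 2 : ℕ) : ℤ) - c n α ≤ (Nat.card {i : Fin n // θ ≤ x i} : ℤ)}

/-- The distribution-free confidence interval for the median computed from the sample `x`. -/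
noncomputable def CI {n : ℕ} (α : ℝ) (x : Fin n → ℝ) : Set ℝ :=
  CI₁ α x ∩ CI₂ α x

/-- The width of a bounded interval. -/
noncomputable def width (s : Set ℝ) : ℝ := Metric.diam s

/-- `ζ = (M/2) min{η, (M/(2C))^{1/δ}}`. -/
noncomputable def zeta (M C δ η : ℝ) : ℝ :=
  M / 2 * min η ((M / (2 * C)) ^ (1 / δ))

/-- The explicit bound on the relative error of the width. -/
noncomputable def bound (M C δ α : ℝ) (n : ℕ) : ℝ :=
  (1 + 14 * Real.log n / z (α / 2)) / (n : ℝ) ^ (1 / 4 : ℝ)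
    + Real.sqrt (Real.log (2 / α) / (8 * n))
    + 2 * C * 14 ^ (1 + δ) * Real.log (2 * n / α) ^ ((1 + δ) / 2)
      / (z (α / 2) * M ^ (1 + δ) * (n : ℝ) ^ (δ / 2))

end MedianCI

/-!
The interval `CI` is `[X₍ₖ₎, X₍ₙ₊₁₋ₖ₎]` with `k = ⌊n/2⌋ - c_{n,α}` (`exists_CI_eq_Icc`), and the proof
compares its width with `z_{α/2} / (√n M)` along the chain

  `n - 2k ≈ √n z_{α/2}`,  `n (F(X₍ₙ₊₁₋ₖ₎) - F(X₍ₖ₎)) ≈ n - 2k`,  `M · width ≈ F(X₍ₙ₊₁₋ₖ₎) - F(X₍ₖ₎)`.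

*The rank.* A weak form of Tusnády's inequality: the upper tail of `2Y - n` at `u`, for
`Y ∼ Bin(n, 1/2)`, lies between the Gaussian tails at `(u + 1 + u²/(4n))/√n` (`gaussian_le_binTail`)
and at `(u - 3)/√n` (`binTail_le_gaussian`). Both follow from comparing the ratio of consecutive
binomial masses, `(1 - t)/(1 + t)` with `t = (u + 1)/(n + 1)`, with the ratio of consecutive Gaussian
cells: once the difference of the two tails starts to decrease it keeps decreasing, so it is
nonnegative as soon as it is so at the two ends of the range (`nonneg_of_unimodal`). Inverting gives
`-z²/4 - 4 ≤ n - 2k - √n z ≤ 3` (`rank_bounds`); the term `z²/4` is the source of the summand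
`√(log(2/α)/(8n))` of the bound, because `z² ≤ 2 log(2/α)`.

*The mass of the interval.* By continuity of `F` the set `{x | p ≤ F x < q}` has mass `q - p`. If
`n (F(X₍ₙ₊₁₋ₖ₎) - F(X₍ₖ₎))` is far from `n - 2k`, then one of at most `n + 1` such sets on a grid of
mesh `1/n` contains far too many or far too few sample points. Chernoff's bound with parameter
`n^{-1/4}` shows that this has probability `O(n^{-2})` (`prob_exists_window_ge`,
`prob_exists_window_le`), with deviations `n^{1/4} (z + O(log n))`; dividing by `√n z` gives the first
summand of the bound.

*The linearisation.* With `r = 14 √(log(2n/α)/n)/M`, the hypothesis on `n` says that `r` lies in the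
range where `F(θ₀ ± r)` differs from `1/2` by at least `M r/2 = 7 √(log(2n/α)/n)`, so by Chernoff's
bound both end points lie within `r` of `θ₀` (`prob_half_line_le`). There the error of the
linearisation is at most `2 C r^{1+δ}`, which gives the last summand (`abs_width_sub_le`).

The hypotheses force `ζ ≤ 1/2`, since `F ≤ 1`; hence `n ≥ 196 log(2n/α)`, and in particular
`n ≥ 1000`, which absorbs all the lower-order constants (`sample_size_bounds`).
-/

namespace MedianCI


/-! ### The standard normal distribution function and its quantiles -/

lemma hasDerivAt_cdf_gaussian (x : ℝ) :
    HasDerivAt (cdf (gaussianReal 0 1)) (gaussianPDFReal 0 1 x) x := by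
  have hcont : Continuous (gaussianPDFReal 0 1) := by
    unfold gaussianPDFReal; fun_prop
  have hint := integrable_gaussianPDFReal 0 1
  have hcdf : ∀ y, cdf (gaussianReal 0 1) y = ∫ t in Set.Iic y, gaussianPDFReal 0 1 t := by
    intro y
    rw [cdf_eq_real, measureReal_def, gaussianReal_apply_eq_integral 0 one_ne_zero,
      ENNReal.toReal_ofReal]
    exact integral_nonneg fun t => gaussianPDFReal_nonneg 0 1 t
  have heq : (cdf (gaussianReal 0 1) : ℝ → ℝ) = fun y =>
      (∫ t in (0 : ℝ)..y, gaussianPDFReal 0 1 t) + cdf (gaussianReal 0 1) 0 := by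
    funext y
    rw [hcdf, hcdf, ← intervalIntegral.integral_Iic_sub_Iic hint.integrableOn hint.integrableOn]
    ring
  rw [heq]
  exact (intervalIntegral.integral_hasDerivAt_right (hint.intervalIntegrable)
    (hcont.stronglyMeasurableAtFilter _ _) hcont.continuousAt).add_const _

lemma continuous_cdf_gaussian : Continuous (cdf (gaussianReal 0 1)) :=
  continuous_iff_continuousAt.2 fun x => (hasDerivAt_cdf_gaussian x).continuousAt

lemma cdf_gaussian_zero : cdf (gaussianReal 0 1) 0 = 1 / 2 := by
  have hna : NullSingletonClass (gaussianReal 0 1) := nullSingletonClass_gaussianReal one_ne_zero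
  have h1 : (gaussianReal 0 1).real (Set.Iic 0) = (gaussianReal 0 1).real (Set.Ici 0) := by
    have := gaussianReal_map_neg (μ := 0) (v := 1)
    rw [neg_zero] at this
    conv_lhs => rw [← this]
    rw [map_measureReal_apply measurable_neg measurableSet_Iic]
    congr 1
    ext x; simp
  have h2 := probReal_compl_eq_one_sub (μ := gaussianReal 0 1) (measurableSet_Iic (a := (0 : ℝ)))
  rw [Set.compl_Iic, measureReal_congr Ioi_ae_eq_Ici] at h2
  rw [cdf_eq_real]
  linarith

lemma one_sub_cdf_gaussian_le {x : ℝ} (hx : 0 ≤ x) :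
    1 - cdf (gaussianReal 0 1) x ≤ Real.exp (-x ^ 2 / 2) := by
  have h2 := probReal_compl_eq_one_sub (μ := gaussianReal 0 1) (measurableSet_Iic (a := x))
  rw [cdf_eq_real, ← h2, Set.compl_Iic]
  have h3 := measure_ge_le_exp_mul_mgf (μ := gaussianReal 0 1) (X := id) x hx
    (integrable_exp_mul_gaussianReal x)
  rw [mgf_id_gaussianReal, ← Real.exp_add] at h3
  refine (measureReal_mono (fun y hy => ?_)).trans (h3.trans (le_of_eq ?_))
  · exact (Set.mem_Ioi.1 hy).le
  · congr 1; push_cast; ring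

/-- Galois connection between the quantile function and the distribution function. -/
lemma z_le_iff {p : ℝ} (hp0 : 0 < p) (hp1 : p < 1) (x : ℝ) :
    z p ≤ x ↔ 1 - p ≤ cdf (gaussianReal 0 1) x := by
  set S : Set ℝ := {x : ℝ | 1 - p ≤ cdf (gaussianReal 0 1) x} with hS
  have hne : S.Nonempty :=
    (((tendsto_cdf_atTop (gaussianReal 0 1)).eventually_const_le
      (show 1 - p < 1 by linarith))).exists
  have hbdd : BddBelow S := by
    obtain ⟨b, hb⟩ := ((tendsto_cdf_atBot (gaussianReal 0 1)).eventually_lt_const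
      (show 0 < 1 - p by linarith)).exists
    refine ⟨b, fun y hy => ?_⟩
    by_contra! hlt
    exact absurd (hy.trans (monotone_cdf _ hlt.le)) (not_le.2 hb)
  have hcl : IsClosed S := isClosed_le continuous_const continuous_cdf_gaussian
  have hmem : z p ∈ S := hcl.csInf_mem hne hbdd
  exact ⟨fun h => le_trans (show 1 - p ≤ _ from hmem) (monotone_cdf _ h), fun h => csInf_le hbdd h⟩

lemma z_pos {p : ℝ} (hp0 : 0 < p) (hp1 : p < 1 / 2) : 0 < z p := by
  by_contra! h
  rw [z_le_iff hp0 (by linarith), cdf_gaussian_zero] at h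
  linarith

lemma z_le_sqrt {p : ℝ} (hp0 : 0 < p) (hp1 : p < 1) :
    z p ≤ Real.sqrt (2 * Real.log (1 / p)) := by
  have hlog : 0 ≤ Real.log (1 / p) := Real.log_nonneg (by rw [le_div_iff₀ hp0]; linarith)
  rw [z_le_iff hp0 hp1]
  have h := one_sub_cdf_gaussian_le (Real.sqrt_nonneg (2 * Real.log (1 / p)))
  rw [Real.sq_sqrt (by positivity), show -(2 * Real.log (1 / p)) / 2 = Real.log p by
    rw [one_div, Real.log_inv]; ring, Real.exp_log hp0] at h
  linarith


/-! ### Comparison of the symmetric binomial tail with the Gaussian tail -/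

/-- The upper tail `P(Y ≥ y)` of `Y ∼ Bin(n, 1/2)`, as an explicit sum. -/
noncomputable def binTail (n y : ℕ) : ℝ :=
  (∑ j ∈ Finset.Ico y (n + 1), (n.choose j : ℝ)) / 2 ^ n

/-- The probability `P(Y = y)` for `Y ∼ Bin(n, 1/2)`. -/
noncomputable def binMass (n y : ℕ) : ℝ := (n.choose y : ℝ) / 2 ^ n

lemma binTail_eq_add (n y : ℕ) : binTail n y = binMass n y + binTail n (y + 1) := by
  unfold binTail binMass
  rcases le_or_gt y n with h | h
  · rw [Finset.sum_eq_sum_Ico_succ_bot (by omega), add_div]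
  · rw [Finset.Ico_eq_empty (by omega), Finset.Ico_eq_empty (by omega), Nat.choose_eq_zero_of_lt h]
    simp

lemma binMass_nonneg (n y : ℕ) : 0 ≤ binMass n y := by unfold binMass; positivity

lemma binTail_nonneg (n y : ℕ) : 0 ≤ binTail n y := by unfold binTail; positivity

lemma binTail_antitone (n : ℕ) : Antitone (binTail n) :=
  antitone_nat_of_succ_le fun y => by
    rw [binTail_eq_add n y]; linarith [binMass_nonneg n y]

lemma binTail_zero (n : ℕ) : binTail n 0 = 1 := by
  unfold binTail
  have := Nat.sum_range_choose n
  rw [← Finset.range_eq_Ico, ← Nat.cast_sum, this]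
  push_cast
  exact div_self (by positivity)

lemma binTail_of_lt {n y : ℕ} (h : n < y) : binTail n y = 0 := by
  unfold binTail
  rw [Finset.Ico_eq_empty (by omega)]; simp

/-- Symmetry of the binomial law: `P(Y ≥ n - k + 1) = P(Y < k)`. -/
lemma binTail_symm {n k : ℕ} (hk : k ≤ n + 1) : binTail n (n + 1 - k) = 1 - binTail n k := by
  have h0 := binTail_zero n
  have h1 : ∑ j ∈ Finset.Ico (n + 1 - k) (n + 1), (n.choose j : ℝ)
      = ∑ j ∈ Finset.range k, (n.choose j : ℝ) := by
    rw [← Finset.sum_range_reflect]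
    rw [Finset.sum_Ico_eq_sum_range, show n + 1 - (n + 1 - k) = k by omega]
    refine Finset.sum_congr rfl fun j hj => ?_
    rw [Finset.mem_range] at hj
    rw [Nat.choose_symm_of_eq_add (show n = (n + 1 - k + j) + (k - 1 - j) by omega)]
  have h2 := Finset.sum_range_add_sum_Ico (fun j => (n.choose j : ℝ)) hk
  unfold binTail at *
  rw [← Finset.range_eq_Ico] at h0
  rw [h1, ← h0, ← h2]
  ring

lemma binMass_succ_mul (n y : ℕ) :
    binMass n (y + 1) * (y + 1) = binMass n y * ((n : ℝ) - y) := by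
  unfold binMass
  have h := Nat.choose_succ_right_eq n y
  rcases le_or_gt y n with hy | hy
  · have h' : (n.choose (y + 1) : ℝ) * (y + 1) = n.choose y * ((n : ℝ) - y) := by
      rw [← Nat.cast_sub hy]; exact_mod_cast h
    rw [div_mul_eq_mul_div, h', div_mul_eq_mul_div]
  · rw [Nat.choose_eq_zero_of_lt hy, Nat.choose_eq_zero_of_lt (by omega)]; simp

lemma binomial_half_real_ge (n y : ℕ) :
    (binomial n half).real {k : ℕ | y ≤ k} = binTail n y := by
  have hae : ({k : ℕ | y ≤ k} : Set ℕ) =ᵐ[binomial n half]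
      ((Finset.Ico y (n + 1) : Finset ℕ) : Set ℕ) := by
    have := ae_le_of_hasLaw_binomial (P := binomial n half) (X := id) (n := n) (p := half) HasLaw.id
    filter_upwards [this] with k hk
    refine propext ?_
    change y ≤ k ↔ k ∈ ((Finset.Ico y (n + 1) : Finset ℕ) : Set ℕ)
    simp only [id] at hk
    simp; omega
  rw [measureReal_congr hae, ← sum_measureReal_singleton]
  unfold binTail
  rw [Finset.sum_div]
  refine Finset.sum_congr rfl fun j hj => ?_
  rw [Finset.mem_Ico] at hj
  rw [binomial_real_singleton]
  have : ((half : unitInterval) : ℝ) = 1 / 2 := rfl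
  rw [this, show (1 : ℝ) - 1 / 2 = 1 / 2 by norm_num, mul_assoc, ← pow_add,
    show j + (n - j) = n by omega, one_div, inv_pow, div_eq_mul_inv]

/-- A sequence that stays nonincreasing from its first nonincreasing step on is nonnegative as
soon as it is nonnegative at both ends. -/
lemma nonneg_of_unimodal {E : ℕ → ℝ} {a b : ℕ} (ha : 0 ≤ E a) (hb : 0 ≤ E b)
    (h : ∀ y, a ≤ y → y + 1 < b → E (y + 1) ≤ E y → E (y + 2) ≤ E (y + 1))
    {y : ℕ} (hay : a ≤ y) (hyb : y ≤ b) : 0 ≤ E y := by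
  by_contra! hneg
  classical
  have hex : ∃ y, a ≤ y ∧ y ≤ b ∧ E y < 0 := ⟨y, hay, hyb, hneg⟩
  obtain ⟨h1, h2, h3⟩ := Nat.find_spec hex
  set m := Nat.find hex with hm
  have hma : a < m := lt_of_le_of_ne h1 fun e => by rw [← e] at h3; linarith
  obtain ⟨m', hm'⟩ : ∃ m', m = m' + 1 := ⟨m - 1, by omega⟩
  have hprev : 0 ≤ E m' := by
    by_contra! hc
    exact Nat.find_min hex (show m' < m by omega) ⟨by omega, by omega, hc⟩
  have hstep : ∀ j, m' + j < b → E (m' + j + 1) ≤ E (m' + j) := by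
    intro j
    induction j with
    | zero => intro _; rw [add_zero, ← hm']; linarith
    | succ j ih => intro hj; exact h (m' + j) (by omega) (by omega) (ih (by omega))
  have hle : ∀ j, m' + 1 + j ≤ b → E (m' + 1 + j) ≤ E m := by
    intro j
    induction j with
    | zero => intro _; rw [add_zero, ← hm']
    | succ j ih =>
      intro hj
      have := hstep (1 + j) (by omega)
      rw [show m' + 1 + (j + 1) = m' + (1 + j) + 1 by omega]
      exact this.trans ((show m' + (1 + j) = m' + 1 + j by omega) ▸ ih (by omega))
  have := hle (b - m) (by omega)
  rw [show m' + 1 + (b - m) = b by omega] at this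
  linarith

/-- Cauchy's mean value theorem for the increments of a decreasing function `B` with density `β`
over consecutive intervals of length `2`. -/
lemma exists_increment_mul_eq {B β : ℝ → ℝ} {u : ℝ}
    (hd : ∀ x, u ≤ x → HasDerivAt B (-β x) x) (hβ : ∀ x, u ≤ x → 0 < β x) :
    B (u + 2) ≤ B u ∧ ∃ c ∈ Set.Ioo u (u + 2),
      (B (u + 2) - B (u + 4)) * β c = (B u - B (u + 2)) * β (c + 2) := by
  have hcont : ContinuousOn B (Set.Icc u (u + 2)) :=
    fun x hx => (hd x hx.1).continuousAt.continuousWithinAt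
  have hshift : ∀ x, u ≤ x → HasDerivAt (fun x => B (x + 2)) (-β (x + 2)) x :=
    fun x hx => (hd (x + 2) (by linarith)).comp_add_const x 2
  refine ⟨?_, ?_⟩
  · obtain ⟨c, hc, h⟩ := exists_hasDerivAt_eq_slope B (fun x => -β x) (show u < u + 2 by linarith)
      hcont (fun x hx => hd x hx.1.le)
    have := hβ c hc.1.le
    rw [eq_div_iff (by linarith)] at h
    nlinarith
  · obtain ⟨c, hc, h⟩ := exists_ratio_hasDerivAt_eq_ratio_slope (fun x => B (x + 2))
      (fun x => -β (x + 2)) (show u < u + 2 by linarith)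
      (fun x hx => (hshift x hx.1).continuousAt.continuousWithinAt)
      (fun x hx => hshift x hx.1.le) B (fun x => -β x) hcont (fun x hx => hd x hx.1.le)
    rw [show u + 2 + 2 = u + 4 by ring] at h
    exact ⟨c, hc, by linarith⟩

/-- If the density `β` of a decreasing function `B` satisfies `β (x + 2) ≤ ρ β x`, then so do the
consecutive increments of `B` over intervals of length `2`. -/
lemma increment_le_mul {B β : ℝ → ℝ} {u ρ : ℝ}
    (hd : ∀ x, u ≤ x → HasDerivAt B (-β x) x) (hβ : ∀ x, u ≤ x → 0 < β x)
    (hρ : ∀ x ∈ Set.Ioo u (u + 2), β (x + 2) ≤ ρ * β x) :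
    B (u + 2) - B (u + 4) ≤ ρ * (B u - B (u + 2)) := by
  obtain ⟨hanti, c, hc, h⟩ := exists_increment_mul_eq hd hβ
  have h4 := mul_le_mul_of_nonneg_left (hρ c hc) (sub_nonneg.2 hanti)
  refine le_of_mul_le_mul_right ?_ (hβ c hc.1.le)
  linarith

/-- The reverse of `increment_le_mul`. -/
lemma mul_le_increment {B β : ℝ → ℝ} {u ρ : ℝ}
    (hd : ∀ x, u ≤ x → HasDerivAt B (-β x) x) (hβ : ∀ x, u ≤ x → 0 < β x)
    (hρ : ∀ x ∈ Set.Ioo u (u + 2), ρ * β x ≤ β (x + 2)) :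
    ρ * (B u - B (u + 2)) ≤ B (u + 2) - B (u + 4) := by
  obtain ⟨hanti, c, hc, h⟩ := exists_increment_mul_eq hd hβ
  have h4 := mul_le_mul_of_nonneg_left (hρ c hc) (sub_nonneg.2 hanti)
  refine le_of_mul_le_mul_right ?_ (hβ c hc.1.le)
  linarith

lemma gaussianPDFReal_zero_one (x : ℝ) :
    gaussianPDFReal 0 1 x = (√(2 * Real.pi))⁻¹ * Real.exp (-x ^ 2 / 2) := by
  simp [gaussianPDFReal]

/-- `(1 - x)/(1 + x) ≤ e^{-2x}`. -/
lemma one_sub_le_one_add_mul_exp {x : ℝ} (h0 : 0 ≤ x) (h1 : x ≤ 1) :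
    1 - x ≤ (1 + x) * Real.exp (-2 * x) := by
  rcases h1.eq_or_lt with rfl | h1
  · have := Real.exp_pos (-2 * 1); linarith
  have h := Real.sum_range_le_log_div h0 h1 1
  simp at h
  have h2 : Real.exp (2 * x) ≤ (1 + x) / (1 - x) := by
    rw [← Real.le_log_iff_exp_le (div_pos (by linarith) (by linarith))]; linarith
  rw [le_div_iff₀ (by linarith)] at h2
  rw [neg_mul, Real.exp_neg, ← div_eq_mul_inv, le_div_iff₀ (Real.exp_pos _)]
  linarith

/-- Third-order bound on `log ((1 + x) / (1 - x))`, in exponential form. -/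
lemma one_add_mul_exp_le {x a : ℝ} (h0 : 0 ≤ x) (h1 : x ≤ 1 / 2)
    (ha : 2 * (x + x ^ 3 / 3 + x ^ 5 / (1 - x ^ 2)) ≤ a) :
    (1 + x) * Real.exp (-a) ≤ 1 - x := by
  have h := Real.log_div_le_sum_range_add h0 (show x < 1 by linarith) 2
  norm_num [Finset.sum_range_succ] at h
  have h2 : (1 + x) / (1 - x) ≤ Real.exp a := by
    rw [← Real.log_le_iff_le_exp (div_pos (by linarith) (by linarith))]; linarith
  rw [div_le_iff₀ (by linarith)] at h2
  rw [Real.exp_neg, ← div_eq_mul_inv, div_le_iff₀ (Real.exp_pos _)]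
  linarith

/-- `e^{-2x - x²} ≤ (1 - x)/(1 + x)` for `x ≤ 1/2`. -/
lemma one_add_mul_exp_quadratic_le {x : ℝ} (h0 : 0 ≤ x) (h1 : x ≤ 1 / 2) :
    (1 + x) * Real.exp (-(2 * x + x ^ 2)) ≤ 1 - x := by
  refine one_add_mul_exp_le h0 h1 ?_
  have h2 : x ^ 5 / (1 - x ^ 2) ≤ x ^ 2 / 6 := by
    rw [div_le_iff₀ (by nlinarith)]
    nlinarith [pow_nonneg h0 2, pow_le_pow_left₀ h0 h1 3, mul_nonneg (pow_nonneg h0 2)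
      (sub_nonneg.2 (pow_le_pow_left₀ h0 h1 3)), mul_nonneg (pow_nonneg h0 2)
      (sub_nonneg.2 (pow_le_pow_left₀ h0 h1 2))]
  nlinarith [mul_nonneg (pow_nonneg h0 2) (sub_nonneg.2 h1)]

/-- The chord bound `e^{-(7/3)x} ≤ (1 - x)/(1 + x)` for `x ≤ 1/2`. -/
lemma one_add_mul_exp_linear_le {x : ℝ} (h0 : 0 ≤ x) (h1 : x ≤ 1 / 2) :
    (1 + x) * Real.exp (-(7 / 3 * x)) ≤ 1 - x := by
  refine one_add_mul_exp_le h0 h1 ?_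
  have h2 : x ^ 5 / (1 - x ^ 2) ≤ x / 12 := by
    rw [div_le_iff₀ (by nlinarith)]
    nlinarith [mul_nonneg h0 (sub_nonneg.2 (pow_le_pow_left₀ h0 h1 4)), mul_nonneg h0
      (sub_nonneg.2 (pow_le_pow_left₀ h0 h1 2))]
  nlinarith [mul_nonneg h0 (sub_nonneg.2 (pow_le_pow_left₀ h0 h1 2))]

lemma half_le_binTail {n y : ℕ} (h : 2 * y ≤ n + 1) : 1 / 2 ≤ binTail n y := by
  have h1 := binTail_symm (n := n) (k := y) (by omega)
  have h2 := binTail_antitone n (show y ≤ n + 1 - y by omega)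
  linarith

lemma binTail_le_half {n y : ℕ} (h : n + 1 ≤ 2 * y) : binTail n y ≤ 1 / 2 := by
  rcases le_or_gt y (n + 1) with hy | hy
  · have h1 := binTail_symm (n := n) (k := y) (by omega)
    have h2 := binTail_antitone n (show n + 1 - y ≤ y by omega)
    linarith
  · rw [binTail_of_lt (by omega)]; norm_num


lemma hasDerivAt_one_sub_cdf_comp {f : ℝ → ℝ} {f' x : ℝ} (s : ℝ) (hf : HasDerivAt f f' x) :
    HasDerivAt (fun u => 1 - cdf (gaussianReal 0 1) (f u / s))
      (-(gaussianPDFReal 0 1 (f x / s) * (f' / s))) x :=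
  ((hasDerivAt_cdf_gaussian (f x / s)).comp x (hf.div_const s)).const_sub 1

/-- The consecutive ratio `(n - y)/(y + 1)` of binomial masses is `(1 - t)/(1 + t)`. -/
lemma sub_div_add_eq {n y : ℝ} (hn : 0 ≤ n) :
    1 - (2 * y - n + 1) / (n + 1) = 2 * (n - y) / (n + 1) ∧
      1 + (2 * y - n + 1) / (n + 1) = 2 * (y + 1) / (n + 1) := by
  have : n + 1 ≠ 0 := by positivity
  constructor <;> field_simp <;> ring

lemma binMass_ratio_le {n y : ℕ} (h1 : n ≤ 2 * y + 1) (h2 : y ≤ n) :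
    ((n : ℝ) - y) / (y + 1) ≤ Real.exp (-2 * ((2 * y - n + 1) / (n + 1))) := by
  have h1' : (n : ℝ) ≤ 2 * y + 1 := by exact_mod_cast h1
  have h2' : (y : ℝ) ≤ n := by exact_mod_cast h2
  obtain ⟨e1, e2⟩ := sub_div_add_eq (y := (y : ℝ)) (Nat.cast_nonneg n)
  have h := one_sub_le_one_add_mul_exp (x := (2 * (y : ℝ) - n + 1) / (n + 1))
    (div_nonneg (by linarith) (by positivity))
    ((div_le_one (by positivity)).2 (by linarith))
  rw [e1, e2, div_mul_eq_mul_div, div_le_div_iff_of_pos_right (by positivity)] at h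
  rw [div_le_iff₀ (by positivity)]
  linarith

lemma le_binMass_ratio {n y : ℕ} {a : ℝ}
    (h : (1 + (2 * (y : ℝ) - n + 1) / (n + 1)) * Real.exp a
      ≤ 1 - (2 * (y : ℝ) - n + 1) / (n + 1)) :
    Real.exp a ≤ ((n : ℝ) - y) / (y + 1) := by
  obtain ⟨e1, e2⟩ := sub_div_add_eq (y := (y : ℝ)) (Nat.cast_nonneg n)
  rw [e1, e2, div_mul_eq_mul_div, div_le_div_iff_of_pos_right (by positivity)] at h
  rw [le_div_iff₀ (by positivity)]
  linarith

lemma binMass_succ (n y : ℕ) :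
    binMass n (y + 1) = ((n : ℝ) - y) / (y + 1) * binMass n y := by
  have h := binMass_succ_mul n y
  have : (y : ℝ) + 1 ≠ 0 := by positivity
  field_simp
  linarith

/-- The upper tail of the symmetric binomial law is at most the Gaussian tail, up to a shift of the
centred variable `2Y - n` by `3`. -/
theorem binTail_le_gaussian {n y : ℕ} (hn : 0 < n) (hy : n + 1 ≤ 2 * y) :
    binTail n y ≤ 1 - cdf (gaussianReal 0 1) ((2 * y - n - 3) / √n) := by
  have hn' : (0 : ℝ) < n := by exact_mod_cast hn
  have hsq : √(n : ℝ) ^ 2 = n := Real.sq_sqrt hn'.le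
  have hs : 0 < √(n : ℝ) := Real.sqrt_pos.2 hn'
  rcases lt_or_ge n y with hyn | hyn
  · rw [binTail_of_lt hyn]; linarith [cdf_le_one (gaussianReal 0 1) ((2 * y - n - 3) / √n)]
  set B : ℝ → ℝ := fun u => 1 - cdf (gaussianReal 0 1) ((u - 3) / √n) with hB
  set β : ℝ → ℝ := fun u => gaussianPDFReal 0 1 ((u - 3) / √n) * (1 / √n) with hβ
  have hBd : ∀ x, HasDerivAt B (-β x) x := fun x =>
    hasDerivAt_one_sub_cdf_comp (√n) ((hasDerivAt_id x).sub_const 3)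
  have hβpos : ∀ x, 0 < β x := fun x =>
    mul_pos (gaussianPDFReal_pos 0 1 _ one_ne_zero) (by positivity)
  set E : ℕ → ℝ := fun y => B (2 * y - n) - binTail n y with hE
  suffices 0 ≤ E y by simpa [hE, hB] using this
  refine nonneg_of_unimodal (a := n / 2 + 1) (b := n + 1) ?_ ?_ ?_ (by omega) (by omega)
  · have h1 := binTail_le_half (n := n) (y := n / 2 + 1) (by omega)
    have h2 : cdf (gaussianReal 0 1) ((2 * ((n / 2 + 1 : ℕ) : ℝ) - n - 3) / √n) ≤ 1 / 2 := by
      rw [← cdf_gaussian_zero]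
      refine monotone_cdf _ (div_nonpos_of_nonpos_of_nonneg ?_ hs.le)
      have : 2 * ((n / 2 + 1 : ℕ) : ℝ) ≤ n + 2 := by exact_mod_cast (by omega)
      linarith
    simp only [hE, hB]
    linarith
  · simp only [hE, hB]
    rw [binTail_of_lt (Nat.lt_succ_self n)]
    linarith [cdf_le_one (gaussianReal 0 1) ((2 * ((n + 1 : ℕ) : ℝ) - n - 3) / √n)]
  · intro j hj1 hj2 hle
    have hj3 : (n : ℝ) ≤ 2 * j := by exact_mod_cast (by omega)
    have hj4 : (j : ℝ) ≤ n := by exact_mod_cast (by omega)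
    have hkey := mul_le_increment (u := 2 * (j : ℝ) - n) (ρ := ((n : ℝ) - j) / (j + 1))
      (fun x _ => hBd x) (fun x _ => hβpos x) (fun x hx => ?_)
    · have e1 := binTail_eq_add n j
      have e2 := binTail_eq_add n (j + 1)
      have e3 := binMass_succ n j
      simp only [hE] at hle ⊢
      push_cast at hle ⊢
      rw [show 2 * ((j : ℝ) + 1) - n = 2 * j - n + 2 by ring] at hle ⊢
      rw [show 2 * ((j : ℝ) + 2) - n = 2 * j - n + 4 by ring]
      have h5 : binMass n j ≤ B (2 * j - n) - B (2 * j - n + 2) := by linarith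
      have h6 := mul_le_mul_of_nonneg_left h5
        (show 0 ≤ ((n : ℝ) - j) / (j + 1) from div_nonneg (by linarith) (by positivity))
      rw [← e3] at h6
      rw [show j + 1 + 1 = j + 2 by ring] at e2
      linarith
    · simp only [hβ, gaussianPDFReal_zero_one, div_pow, hsq]
      have h7 := binMass_ratio_le (n := n) (y := j) (by omega) (by omega)
      have h8 : Real.exp (-2 * ((2 * (j : ℝ) - n + 1) / (n + 1)))
            * Real.exp (-((x - 3) ^ 2 / n) / 2)
          ≤ Real.exp (-((x + 2 - 3) ^ 2 / n) / 2) := by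
        rw [← Real.exp_add, Real.exp_le_exp]
        have h9 : (x - 2) / n ≤ (2 * (j : ℝ) - n + 1) / (n + 1) := by
          rw [div_le_div_iff₀ hn' (by positivity)]
          nlinarith [hx.2]
        have : -((x + 2 - 3) ^ 2 / n) / 2 - -((x - 3) ^ 2 / n) / 2 = -2 * ((x - 2) / n) := by
          field_simp; ring
        linarith
      have h10 := (mul_le_mul_of_nonneg_right h7
        (Real.exp_pos (-((x - 3) ^ 2 / n) / 2)).le).trans h8
      have hc : 0 ≤ (√(2 * Real.pi))⁻¹ * (1 / √(n : ℝ)) := by positivity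
      have h11 := mul_le_mul_of_nonneg_right h10 hc
      nlinarith [h11]

lemma inv_le_binMass_center (n : ℕ) : 1 / ((n : ℝ) + 1) ≤ binMass n ((n + 1) / 2) := by
  have h1 : n.choose ((n + 1) / 2) = n.choose (n / 2) :=
    Nat.choose_symm_of_eq_add (by omega)
  have h2 : 2 ^ n ≤ (n + 1) * n.choose (n / 2) := by
    rw [← Nat.sum_range_choose]
    calc ∑ m ∈ Finset.range (n + 1), n.choose m
        ≤ ∑ m ∈ Finset.range (n + 1), n.choose (n / 2) :=
          Finset.sum_le_sum fun m _ => Nat.choose_le_middle m n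
      _ = _ := by simp
  unfold binMass
  rw [h1, div_le_div_iff₀ (by positivity) (by positivity), one_mul]
  have : ((2 ^ n : ℕ) : ℝ) ≤ (((n + 1) * n.choose (n / 2) : ℕ) : ℝ) := by exact_mod_cast h2
  push_cast at this
  linarith

/-- Lower bound on the binomial masses up to three quarters of the range. -/
lemma exp_le_binMass {n y : ℕ} (hy : (n + 1) / 2 ≤ y) (hy' : 4 * y ≤ 3 * n) :
    Real.exp (-(7 / 12 * (2 * (y : ℝ) - n) ^ 2 / (n + 1))) / (n + 1) ≤ binMass n y := by
  induction y, hy using Nat.le_induction with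
  | base =>
    refine le_trans ?_ (inv_le_binMass_center n)
    gcongr
    rw [Real.exp_le_one_iff, neg_nonpos]
    positivity
  | succ y hy ih =>
    have h1 : (n : ℝ) ≤ 2 * y := by exact_mod_cast (by omega)
    have h2 : 4 * (y : ℝ) + 1 ≤ 3 * n := by exact_mod_cast (by omega)
    have h3 := le_binMass_ratio (n := n) (y := y) (one_add_mul_exp_linear_le
      (x := (2 * (y : ℝ) - n + 1) / (n + 1)) (div_nonneg (by linarith) (by positivity))
      (by rw [div_le_iff₀ (by positivity)]; linarith))
    rw [binMass_succ]
    refine le_trans (le_of_eq ?_) (mul_le_mul h3 (ih (by omega)) (by positivity)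
      (div_nonneg (by linarith) (by positivity)))
    rw [← mul_div_assoc, ← Real.exp_add]
    congr 2
    push_cast
    field_simp
    ring

/-- Consecutive values, at distance `2`, of the Gaussian density transported by
`f u = u + 1 + u² / (4n)` decrease at least as fast as `e^{-(2t + t²)}`, for `t ≤ (x + 1)/n`. The
linear term of `f` provides `e^{-2t}`, its quadratic term provides `e^{-t²}`, and its constant term
compensates for the growth of `f'`. -/
lemma quadratic_density_step {n x t ρ : ℝ} (hn' : 0 < n) (hx0 : 0 ≤ x) (ht0 : 0 ≤ t)
    (htw : t ≤ (x + 1) / n) (h7 : Real.exp (-(2 * t + t ^ 2)) ≤ ρ) :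
    Real.exp (-((x + 2 + 1 + (x + 2) ^ 2 / (4 * n)) ^ 2 / n) / 2) * (1 + (x + 2) / (2 * n))
      ≤ ρ * (Real.exp (-((x + 1 + x ^ 2 / (4 * n)) ^ 2 / n) / 2) * (1 + x / (2 * n))) := by
  set f : ℝ → ℝ := fun u => u + 1 + u ^ 2 / (4 * n) with hf
  set w : ℝ := (x + 1) / n with hw
  have hxw : x = n * w - 1 := by rw [hw]; field_simp; ring
  have h8 : Real.exp (-(f (x + 2) ^ 2 / n) / 2) * Real.exp (1 / n)
      ≤ Real.exp (-(2 * t + t ^ 2)) * Real.exp (-(f x ^ 2 / n) / 2) := by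
    rw [← Real.exp_add, ← Real.exp_add, Real.exp_le_exp]
    have h9 : f (x + 2) - f x = 2 + w := by
      simp only [hf, hw]; field_simp; ring
    have h10 : 2 * (n * w + 1) ≤ f (x + 2) + f x := by
      have : 0 ≤ (x + 2) ^ 2 / (4 * n) + x ^ 2 / (4 * n) := by positivity
      simp only [hf]; linarith
    have hw0 : 0 ≤ w := by linarith
    have h11 : (2 + w) * (2 * (n * w + 1)) ≤ f (x + 2) ^ 2 - f x ^ 2 := by
      rw [sq_sub_sq, h9, mul_comm]
      exact mul_le_mul_of_nonneg_right h10 (by linarith)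
    have h12 : (2 + w) * (2 * (n * w + 1)) / n
        = 2 * (2 * w + w ^ 2) + 2 * (2 / n) + 2 * (w / n) := by
      field_simp; ring
    have h13 := div_le_div_of_nonneg_right h11 hn'.le
    rw [h12, sub_div] at h13
    have h14 : 0 ≤ w / n := by positivity
    have h15 : (2 : ℝ) / n = 2 * (1 / n) := by ring
    have h16 : 0 ≤ 1 / (n : ℝ) := by positivity
    nlinarith
  have h17 : 1 + (x + 2) / (2 * n) ≤ (1 + x / (2 * n)) * Real.exp (1 / n) := by
    have h18 := Real.add_one_le_exp (1 / (n : ℝ))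
    have h19 : (x + 2) / (2 * (n : ℝ)) = x / (2 * n) + 1 / n := by field_simp
    have h20 : 0 ≤ x / (2 * (n : ℝ)) := by positivity
    have h21 : 0 ≤ 1 / (n : ℝ) := by positivity
    nlinarith
  calc _ ≤ Real.exp (-(f (x + 2) ^ 2 / n) / 2) * ((1 + x / (2 * n)) * Real.exp (1 / n)) := by
        gcongr
    _ = (Real.exp (-(f (x + 2) ^ 2 / n) / 2) * Real.exp (1 / n)) * (1 + x / (2 * n)) := by ring
    _ ≤ (Real.exp (-(2 * t + t ^ 2)) * Real.exp (-(f x ^ 2 / n) / 2)) * (1 + x / (2 * n)) := by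
        gcongr
    _ ≤ (ρ * Real.exp (-(f x ^ 2 / n) / 2)) * (1 + x / (2 * n)) := by gcongr
    _ = _ := by ring

/-- The upper tail of the symmetric binomial law at `y`, with `u = 2y - n`, is at least the Gaussian
tail at `(u + 1 + u² / (4n)) / √n`. -/
theorem gaussian_le_binTail {n y : ℕ} (hn : 1000 ≤ n) (hlog : Real.log (n + 1) ≤ n / 196)
    (hy : n ≤ 2 * y) (hy' : 4 * y ≤ 3 * n) :
    1 - cdf (gaussianReal 0 1)
      ((2 * y - n + 1 + (2 * y - n) ^ 2 / (4 * n)) / √n) ≤ binTail n y := by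
  have hn1 : (1000 : ℝ) ≤ n := by exact_mod_cast hn
  have hn' : (0 : ℝ) < n := by linarith
  have hsq : √(n : ℝ) ^ 2 = n := Real.sq_sqrt hn'.le
  have hs : 0 < √(n : ℝ) := Real.sqrt_pos.2 hn'
  set f : ℝ → ℝ := fun u => u + 1 + u ^ 2 / (4 * n) with hf
  set B : ℝ → ℝ := fun u => 1 - cdf (gaussianReal 0 1) (f u / √n) with hB
  set β : ℝ → ℝ := fun u => gaussianPDFReal 0 1 (f u / √n) * ((1 + u / (2 * n)) / √n) with hβ
  have hBd : ∀ x, HasDerivAt B (-β x) x := fun x => by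
    have hfd : HasDerivAt f (1 + x / (2 * n)) x := by
      have := ((hasDerivAt_id x).add_const 1).add
        (((hasDerivAt_id x).pow 2).div_const (4 * (n : ℝ)))
      refine this.congr_deriv ?_
      simp; field_simp; ring
    exact hasDerivAt_one_sub_cdf_comp (√n) hfd
  set E : ℕ → ℝ := fun y => binTail n y - B (2 * y - n) with hE
  suffices 0 ≤ E y by simp only [hE, hB, hf] at this; linarith
  refine nonneg_of_unimodal (a := (n + 1) / 2) (b := 3 * n / 4) ?_ ?_ ?_ (by omega) (by omega)
  · have h1 := half_le_binTail (n := n) (y := (n + 1) / 2) (by omega)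
    have h3 : (n : ℝ) ≤ 2 * ((n + 1) / 2 : ℕ) := by exact_mod_cast (by omega)
    have h2 : 1 / 2 ≤ cdf (gaussianReal 0 1) (f (2 * ((n + 1) / 2 : ℕ) - n) / √n) := by
      rw [← cdf_gaussian_zero]
      refine monotone_cdf _ (div_nonneg ?_ hs.le)
      have : (0 : ℝ) ≤ 2 * ((n + 1) / 2 : ℕ) - n := by linarith
      simp only [hf]; positivity
    simp only [hE, hB]
    linarith
  -- at the right end a single binomial mass already exceeds the whole Gaussian tail
  · set b := 3 * n / 4 with hb
    have hb1 : (n : ℝ) / 2 - 3 / 2 ≤ 2 * b - n := by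
      have : (3 : ℝ) * n ≤ 4 * b + 3 := by exact_mod_cast (by omega)
      linarith
    set m : ℝ := 2 * b - n with hm
    have hm0 : 0 ≤ m := by linarith
    have h1 := exp_le_binMass (n := n) (y := b) (by omega) (by omega)
    have h2 : binMass n b ≤ binTail n b := by
      rw [binTail_eq_add]; linarith [binTail_nonneg n (b + 1)]
    have h3 : B m ≤ Real.exp (-(f m / √n) ^ 2 / 2) :=
      one_sub_cdf_gaussian_le (div_nonneg (by simp only [hf]; positivity) hs.le)
    have h4 : Real.exp (-(f m / √n) ^ 2 / 2)
        ≤ Real.exp (-(7 / 12 * (2 * (b : ℝ) - n) ^ 2 / (n + 1))) / (n + 1) := by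
      rw [le_div_iff₀ (by positivity)]
      conv_lhs => rw [← Real.exp_log (show (0 : ℝ) < n + 1 by positivity)]
      rw [← Real.exp_add, Real.exp_le_exp, ← hm, div_pow, hsq]
      have h5 : 7 / 12 * m ^ 2 / (n + 1) ≤ 7 / 12 * (m ^ 2 / n) := by
        rw [mul_div_assoc]; gcongr; linarith
      have h6 : 1.12 * m ≤ f m := by
        have : 0.12 * m ≤ m ^ 2 / (4 * n) := by
          rw [le_div_iff₀ (by positivity)]; nlinarith
        simp only [hf]; linarith
      have h7 : 1.2544 * (m ^ 2 / n) ≤ f m ^ 2 / n := by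
        rw [← mul_div_assoc]; gcongr; nlinarith
      have h8 : 0.2 * n ≤ m ^ 2 / n := by
        rw [le_div_iff₀ hn']; nlinarith
      rw [neg_div]
      linarith
    simp only [hE]
    linarith
  · intro j hj1 hj2 hle
    have hj3 : (n : ℝ) ≤ 2 * j := by exact_mod_cast (by omega)
    have hj4 : 4 * (j : ℝ) + 1 ≤ 3 * n := by exact_mod_cast (by omega)
    set ρ : ℝ := ((n : ℝ) - j) / (j + 1) with hρ
    have hkey := increment_le_mul (u := 2 * (j : ℝ) - n) (ρ := ρ)
      (fun x _ => hBd x) (fun x hx => ?_) (fun x hx => ?_)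
    · have e1 := binTail_eq_add n j
      have e2 := binTail_eq_add n (j + 1)
      have e3 := binMass_succ n j
      simp only [hE] at hle ⊢
      push_cast at hle ⊢
      rw [show 2 * ((j : ℝ) + 1) - n = 2 * j - n + 2 by ring] at hle ⊢
      rw [show 2 * ((j : ℝ) + 2) - n = 2 * j - n + 4 by ring]
      have h5 : B (2 * j - n) - B (2 * j - n + 2) ≤ binMass n j := by linarith
      have h6 := mul_le_mul_of_nonneg_left h5
        (show 0 ≤ ρ from div_nonneg (by linarith) (by positivity))
      rw [← e3] at h6
      rw [show j + 1 + 1 = j + 2 by ring] at e2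
      linarith
    · have : 0 ≤ x := by linarith
      exact mul_pos (gaussianPDFReal_pos 0 1 _ one_ne_zero) (by positivity)
    · have hx0 : 0 ≤ x := by linarith [hx.1]
      set t : ℝ := (2 * (j : ℝ) - n + 1) / (n + 1) with ht
      have ht0 : 0 ≤ t := div_nonneg (by linarith) (by positivity)
      have h7 : Real.exp (-(2 * t + t ^ 2)) ≤ ρ := le_binMass_ratio
        (one_add_mul_exp_quadratic_le ht0 (by rw [div_le_iff₀ (by positivity)]; linarith))
      have h22 := quadratic_density_step hn' hx0 ht0 (by
        rw [div_le_div_iff₀ (by positivity) hn']; nlinarith [hx.1]) h7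
      have hc : 0 ≤ (√(2 * Real.pi))⁻¹ * (1 / √(n : ℝ)) := by positivity
      have h23 := mul_le_mul_of_nonneg_right h22 hc
      simp only [hβ, gaussianPDFReal_zero_one, div_pow, hsq]
      refine (le_of_eq ?_).trans (h23.trans (le_of_eq ?_)) <;> ring


/-! ### The rank of the end points of the interval -/

/-- The integer `k = ⌊n/2⌋ - c_{n,α}` is the largest `k` with `P(Y ≥ k) ≥ 1 - α/2`, and it is
nonnegative because `P(Y ≥ 0) = 1`. -/
lemma exists_rank (n : ℕ) {α : ℝ} (hα0 : 0 < α) (hα1 : α < 1) :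
    ∃ k : ℕ, ((n / 2 : ℕ) : ℤ) - c n α = k ∧ 1 - α / 2 ≤ binTail n k ∧
      binTail n (k + 1) < 1 - α / 2 := by
  set h : ℤ := ((n / 2 : ℕ) : ℤ) with hh
  set S : Set ℤ := {x : ℤ | 1 - α / 2 ≤
    (binomial n half).real {k : ℕ | h - x ≤ (k : ℤ)}} with hS
  have hval : ∀ j : ℕ, (binomial n half).real {k : ℕ | ((j : ℤ)) ≤ (k : ℤ)} = binTail n j := by
    intro j
    rw [← binomial_half_real_ge]
    simp
  have hmem : h ∈ S := by
    have := hval 0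
    rw [binTail_zero] at this
    simp only [hS, Set.mem_ofPred_eq, sub_self]
    push_cast at this
    rw [this]; linarith
  have hbdd : BddBelow S := by
    refine ⟨h - n, fun x hx => ?_⟩
    by_contra! hlt
    have h1 : (binomial n half).real {k : ℕ | h - x ≤ (k : ℤ)} ≤ binTail n (n + 1) := by
      rw [← hval]
      exact measureReal_mono fun k (hk : h - x ≤ (k : ℤ)) =>
        show ((n + 1 : ℕ) : ℤ) ≤ k by push_cast; omega
    rw [binTail_of_lt (Nat.lt_succ_self n)] at h1
    have h2 : 1 - α / 2 ≤ (binomial n half).real {k : ℕ | h - x ≤ (k : ℤ)} := hx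
    linarith
  have hc : c n α ∈ S := Int.csInf_mem ⟨h, hmem⟩ hbdd
  have hle : c n α ≤ h := csInf_le hbdd hmem
  obtain ⟨k, hk⟩ := Int.eq_ofNat_of_zero_le (sub_nonneg.2 hle)
  refine ⟨k, hk, ?_, ?_⟩
  · rw [← hval k, ← hk]; exact hc
  · by_contra! hcon
    rw [← hval (k + 1)] at hcon
    have : c n α - 1 ∈ S := by
      change 1 - α / 2 ≤ (binomial n half).real {j : ℕ | h - (c n α - 1) ≤ (j : ℤ)}
      rwa [show h - (c n α - 1) = ((k + 1 : ℕ) : ℤ) by push_cast; omega]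
    have := csInf_le hbdd this
    change c n α ≤ _ at this
    omega

/-- The rank `k = ⌊n/2⌋ - c_{n,α}` satisfies `n - 2k = √n z_{α/2} + O(1 + z_{α/2}²)`. -/
lemma rank_bounds {n k : ℕ} {α : ℝ} (hα0 : 0 < α) (hα1 : α < 1) (hn : 1000 ≤ n)
    (hlog : Real.log (n + 1) ≤ n / 196) (hlogb : Real.logb 2 (2 / α) ≤ n)
    (hz : z (α / 2) ≤ 0.11 * √n)
    (hk1 : 1 - α / 2 ≤ binTail n k) (hk2 : binTail n (k + 1) < 1 - α / 2) :
    1 ≤ k ∧ 2 * k ≤ n ∧ (n : ℝ) - 2 * k ≤ z (α / 2) * √n + 3 ∧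
      z (α / 2) * √n - z (α / 2) ^ 2 / 4 - 4 ≤ (n : ℝ) - 2 * k := by
  have hn1 : (1000 : ℝ) ≤ n := by exact_mod_cast hn
  have hn' : (0 : ℝ) < n := by linarith
  have hs : 0 < √(n : ℝ) := Real.sqrt_pos.2 hn'
  have hsq : √(n : ℝ) * √n = n := Real.mul_self_sqrt hn'.le
  have hz0 : 0 < z (α / 2) := z_pos (by linarith) (by linarith)
  have hpos : 1 ≤ k := by
    by_contra! hk0
    obtain rfl : k = 0 := by omega
    have h1 := binTail_eq_add n 0
    rw [binTail_zero] at h1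
    have h2 : binMass n 0 ≤ α / 2 := by
      rw [Real.logb_le_iff_le_rpow (by norm_num) (by positivity), Real.rpow_natCast] at hlogb
      unfold binMass
      rw [Nat.choose_zero_right, Nat.cast_one, div_le_iff₀ (by positivity)]
      rw [div_le_iff₀ hα0] at hlogb
      linarith
    rw [zero_add] at h1 hk2
    linarith
  have hhalf : 2 * k ≤ n := by
    by_contra! hk
    linarith [binTail_le_half (n := n) (y := k) (by omega)]
  have hupper : (n : ℝ) - 2 * k ≤ z (α / 2) * √n + 3 := by
    rcases Nat.lt_or_ge n (2 * (n - k)) with hlt | hge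
    · have h1 := binTail_symm (n := n) (k := k + 1) (by omega)
      rw [show n + 1 - (k + 1) = n - k by omega] at h1
      have h2 := binTail_le_gaussian (n := n) (y := n - k) (by omega) (by omega)
      rw [Nat.cast_sub (by omega)] at h2
      have h3 : ¬ z (α / 2) ≤ (2 * ((n : ℝ) - k) - n - 3) / √n := by
        rw [z_le_iff (by linarith) (by linarith)]
        linarith
      rw [not_le, div_lt_iff₀ hs] at h3
      linarith
    · have : (n : ℝ) ≤ 2 * k := by exact_mod_cast (by omega)
      have := mul_pos hz0 hs
      linarith
  refine ⟨hpos, hhalf, hupper, ?_⟩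
  have hzn : z (α / 2) * √n ≤ 0.11 * n := by nlinarith
  have hhalf' : 2 * (k : ℝ) ≤ n := by exact_mod_cast hhalf
  -- `z ≤ 0.11 √n` keeps the rank inside the range of `gaussian_le_binTail`
  have h4 : 4 * (n + 1 - k) ≤ 3 * n := by
    have : (n : ℝ) + 4 ≤ 4 * k := by linarith
    have : n + 4 ≤ 4 * k := by exact_mod_cast this
    omega
  have h1 := binTail_symm (n := n) (k := k) (by omega)
  have h2 := gaussian_le_binTail (y := n + 1 - k) hn hlog (by omega) h4
  rw [h1, Nat.cast_sub (by omega)] at h2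
  push_cast at h2
  rw [show 2 * ((n : ℝ) + 1 - k) - n = (n - 2 * k) + 2 by ring] at h2
  set D : ℝ := (n : ℝ) - 2 * k with hD
  have h3 : z (α / 2) ≤ (D + 2 + 1 + (D + 2) ^ 2 / (4 * n)) / √n := by
    rw [z_le_iff (by linarith) (by linarith)]
    linarith
  rw [le_div_iff₀ hs] at h3
  have h5 : (D + 2) ^ 2 / (4 * n) ≤ z (α / 2) ^ 2 / 4 + 1 := by
    rw [div_le_iff₀ (by positivity)]
    have h6 : (D + 2) ^ 2 ≤ (z (α / 2) * √n + 5) ^ 2 :=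
      pow_le_pow_left₀ (by linarith) (by linarith) 2
    have h7 : (z (α / 2) * √n) ^ 2 = z (α / 2) ^ 2 * n := by
      rw [mul_pow, sq √(n : ℝ), hsq]
    nlinarith
  linarith

/-! ### Order statistics -/

lemma card_mono {n : ℕ} {p q : Fin n → Prop} (h : ∀ i, p i → q i) :
    Nat.card {i // p i} ≤ Nat.card {i // q i} :=
  Nat.card_mono (s := {i | p i}) (t := {i | q i}) (Set.toFinite _) h

/-- The order statistic of rank `k`: at least `k` sample points lie at or below `θ` exactly when
`lo ≤ θ`, and fewer than `k` lie strictly below `lo`. -/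
lemma exists_lower_orderStat {n k : ℕ} (x : Fin n → ℝ) (hk : 1 ≤ k) (hkn : k ≤ n) :
    ∃ lo : ℝ, (∀ θ, k ≤ Nat.card {i // x i ≤ θ} ↔ lo ≤ θ) ∧ Nat.card {i // x i < lo} < k := by
  classical
  -- a sufficiently large lower part of the sample has a largest element, of rank at least `k`
  have hmax : ∀ p : Fin n → Prop, k ≤ Nat.card {i // p i} →
      ∃ i, p i ∧ k ≤ Nat.card {j // x j ≤ x i} := by
    intro p hp
    have hne : (Finset.univ.filter p).Nonempty := by
      rw [← Finset.card_pos, ← Fintype.card_subtype, ← Nat.card_eq_fintype_card]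
      omega
    obtain ⟨i, hi, hi2⟩ := Finset.exists_max_image _ x hne
    rw [Finset.mem_filter] at hi
    exact ⟨i, hi.2, hp.trans (card_mono fun j hj => hi2 j (by simpa using hj))⟩
  set T := Finset.univ.filter fun i => k ≤ Nat.card {j // x j ≤ x i} with hT
  have hTne : T.Nonempty := by
    obtain ⟨i, -, hi⟩ := hmax (fun _ => True) (by simpa using hkn)
    exact ⟨i, by simpa [hT] using hi⟩
  obtain ⟨i₀, hi₀, hmin⟩ := Finset.exists_min_image T x hTne
  have hi₀' : k ≤ Nat.card {j // x j ≤ x i₀} := (Finset.mem_filter.1 hi₀).2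
  refine ⟨x i₀, fun θ => ⟨fun h => ?_, fun h => ?_⟩, ?_⟩
  · obtain ⟨i, hi, hi2⟩ := hmax _ h
    exact (hmin i (by simpa [hT] using hi2)).trans hi
  · exact hi₀'.trans (card_mono fun j hj => hj.trans h)
  · by_contra! h
    obtain ⟨i, hi, hi2⟩ := hmax _ h
    exact absurd (hmin i (by simpa [hT] using hi2)) (not_le.2 hi)

lemma exists_upper_orderStat {n k : ℕ} (x : Fin n → ℝ) (hk : 1 ≤ k) (hkn : k ≤ n) :
    ∃ hi : ℝ, (∀ θ, k ≤ Nat.card {i // θ ≤ x i} ↔ θ ≤ hi) ∧ Nat.card {i // hi < x i} < k := by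
  obtain ⟨lo, h1, h2⟩ := exists_lower_orderStat (fun i => -x i) hk hkn
  refine ⟨-lo, fun θ => ?_, ?_⟩
  · have := h1 (-θ)
    simp only [neg_le_neg_iff] at this
    rw [this, le_neg]
  · simpa only [neg_lt] using h2

lemma card_add_card_not {n : ℕ} (p : Fin n → Prop) :
    Nat.card {i // p i} + Nat.card {i // ¬ p i} = n := by
  classical
  rw [Nat.card_eq_fintype_card, Nat.card_eq_fintype_card, Fintype.card_subtype_compl,
    Fintype.card_fin]
  have := Fintype.card_subtype_le p
  rw [Fintype.card_fin] at this
  omega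

lemma card_or_le {n : ℕ} (p q : Fin n → Prop) :
    Nat.card {i // p i ∨ q i} ≤ Nat.card {i // p i} + Nat.card {i // q i} := by
  classical
  simp only [Nat.card_eq_fintype_card]
  exact Fintype.card_subtype_or p q

lemma card_or_eq {n : ℕ} (p q : Fin n → Prop) (h : ∀ i, p i → ¬ q i) :
    Nat.card {i // p i ∨ q i} = Nat.card {i // p i} + Nat.card {i // q i} := by
  classical
  simp only [Nat.card_eq_fintype_card]
  refine Fintype.card_subtype_or_disjoint p q ?_
  rw [Pi.disjoint_iff]
  intro i
  simpa [disjoint_iff] using h i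

/-- The confidence interval is the interval `[lo, hi]` between the order statistics of ranks `k` and
`n + 1 - k`. The last two properties count the sample points inside and around it. -/
lemma exists_CI_eq_Icc {n k : ℕ} {α : ℝ} (x : Fin n → ℝ)
    (hc : ((n / 2 : ℕ) : ℤ) - c n α = k) (hk : 1 ≤ k) (hkn : 2 * k ≤ n) :
    ∃ lo hi : ℝ, lo ≤ hi ∧ CI α x = Set.Icc lo hi ∧
      (∀ t, Nat.card {i // x i ∈ Set.Iic t} < k → t < lo) ∧
      (∀ t, Nat.card {i // x i ∈ Set.Ici t} < k → hi < t) ∧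
      (∀ S : Set ℝ, S ⊆ Set.Ioo lo hi → lo < hi → Nat.card {i // x i ∈ S} + 2 * k ≤ n) ∧
      (∀ S : Set ℝ, Set.Icc lo hi ⊆ S → n + 2 ≤ Nat.card {i // x i ∈ S} + 2 * k) := by
  obtain ⟨lo, hlo1, hlo2⟩ := exists_lower_orderStat x hk (by omega)
  obtain ⟨hi, hhi1, hhi2⟩ := exists_upper_orderStat x hk (by omega)
  refine ⟨lo, hi, ?_, ?_, fun t ht => ?_, fun t ht => ?_, fun S hS hlt => ?_, fun S hS => ?_⟩
  · rw [← hhi1]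
    have := card_add_card_not fun i => x i < lo
    simp only [not_lt] at this
    omega
  · ext θ
    simp only [CI, CI₁, CI₂, hc, Set.mem_inter_iff, Set.mem_ofPred_eq, Set.mem_Icc, Nat.cast_le,
      hlo1, hhi1]
  · by_contra! h
    exact absurd ((hlo1 t).2 h) (not_le.2 ht)
  · by_contra! h
    exact absurd ((hhi1 t).2 h) (not_le.2 ht)
  · have h1 := (hlo1 lo).2 le_rfl
    have h2 := (hhi1 hi).2 le_rfl
    have h3 := card_or_eq (fun i => x i ≤ lo) (fun i => hi ≤ x i)
      fun i h h' => absurd (h'.trans h) (not_le.2 hlt)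
    have h4 := card_add_card_not fun i => x i ≤ lo ∨ hi ≤ x i
    have h5 : Nat.card {i // x i ∈ S} ≤ Nat.card {i // ¬ (x i ≤ lo ∨ hi ≤ x i)} :=
      card_mono fun i h => by
        have := hS h
        rw [not_or, not_le, not_le]
        exact this
    omega
  · have h3 := card_or_le (fun i => x i < lo) (fun i => hi < x i)
    have h4 := card_add_card_not fun i => x i < lo ∨ hi < x i
    have h5 : Nat.card {i // ¬ (x i < lo ∨ hi < x i)} ≤ Nat.card {i // x i ∈ S} :=
      card_mono fun i h => by
        rw [not_or, not_lt, not_lt] at h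
        exact hS h
    omega

/-! ### Concentration of the number of sample points in a set -/

section Chernoff

variable {Ω : Type*} [MeasurableSpace Ω] {P : Measure Ω}
  {ν : Measure ℝ} [IsProbabilityMeasure ν] {n : ℕ} {X : Fin n → Ω → ℝ} {S : Set ℝ}

lemma natCast_card_eq_sum_indicator (x : Fin n → ℝ) (S : Set ℝ) :
    (Nat.card {i // x i ∈ S} : ℝ) = ∑ i, S.indicator 1 (x i) := by
  classical
  rw [Nat.card_eq_fintype_card, Fintype.card_subtype, Finset.card_filter]
  push_cast
  exact Finset.sum_congr rfl fun i _ => by simp [Set.indicator_apply]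

lemma exp_mul_indicator (t x : ℝ) (S : Set ℝ) :
    Real.exp (t * S.indicator 1 x) = 1 + (Real.exp t - 1) * S.indicator 1 x := by
  by_cases h : x ∈ S <;> simp [h]

lemma mgf_indicator_le (hX : ∀ i, HasLaw (X i) ν P) (hS : MeasurableSet S) (t : ℝ) (i : Fin n) :
    mgf (fun ω => S.indicator 1 (X i ω)) P t
      ≤ Real.exp (ν.real S * (Real.exp t - 1)) := by
  have hm : Measurable (S.indicator (1 : ℝ → ℝ)) := measurable_one.indicator hS
  have hint : Integrable (S.indicator (1 : ℝ → ℝ)) ν :=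
    (integrable_const (1 : ℝ)).indicator hS
  have h1 : mgf (fun ω => S.indicator 1 (X i ω)) P t
      = ∫ x, (1 + (Real.exp t - 1) * S.indicator 1 x) ∂ν := by
    rw [mgf, ← (hX i).integral_comp (by fun_prop)]
    simp only [exp_mul_indicator, Function.comp_def]
  rw [h1, integral_add (integrable_const _) (hint.const_mul _), integral_const_mul,
    integral_indicator_one hS, integral_const]
  have := Real.add_one_le_exp (ν.real S * (Real.exp t - 1))
  simp
  linarith

/-- The moment generating function of the number of sample points in `S` is at most that of a Poisson
variable with the same mean. -/
lemma mgf_card_le (hX : ∀ i, HasLaw (X i) ν P) (hind : iIndepFun X P) (hS : MeasurableSet S)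
    (t : ℝ) :
    Integrable (fun ω => Real.exp (t * (Nat.card {i // X i ω ∈ S} : ℝ))) P ∧
    mgf (fun ω => (Nat.card {i // X i ω ∈ S} : ℝ)) P t
      ≤ Real.exp (n * ν.real S * (Real.exp t - 1)) := by
  have := hind.isProbabilityMeasure
  have hm : Measurable (S.indicator (1 : ℝ → ℝ)) := measurable_one.indicator hS
  have hmX : ∀ i, AEMeasurable (fun ω => S.indicator (1 : ℝ → ℝ) (X i ω)) P := fun i =>
    hm.comp_aemeasurable (hX i).aemeasurable
  have heq : (fun ω => (Nat.card {i // X i ω ∈ S} : ℝ))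
      = ∑ i, fun ω => S.indicator (1 : ℝ → ℝ) (X i ω) := by
    funext ω
    rw [natCast_card_eq_sum_indicator (fun i => X i ω) S, Finset.sum_apply]
  have hmeas : AEMeasurable (fun ω => (Nat.card {i // X i ω ∈ S} : ℝ)) P := by
    rw [heq]; exact Finset.aemeasurable_sum _ fun i _ => hmX i
  refine ⟨?_, ?_⟩
  · refine Integrable.of_bound (C := Real.exp (|t| * n))
      ((hmeas.const_mul t).exp.aestronglyMeasurable) (ae_of_all _ fun ω => ?_)
    rw [Real.norm_eq_abs, Real.abs_exp, Real.exp_le_exp]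
    have h1 : (Nat.card {i // X i ω ∈ S} : ℝ) ≤ n := by
      have := card_add_card_not fun i => X i ω ∈ S
      exact_mod_cast (by omega)
    calc t * (Nat.card {i // X i ω ∈ S} : ℝ) ≤ |t| * (Nat.card {i // X i ω ∈ S} : ℝ) := by
          gcongr; exact le_abs_self t
      _ ≤ |t| * n := by gcongr
  · have hind' : iIndepFun (fun i ω => S.indicator (1 : ℝ → ℝ) (X i ω)) P :=
      hind.comp (fun _ => S.indicator (1 : ℝ → ℝ)) fun _ => hm
    rw [heq, hind'.mgf_sum₀ hmX]
    calc ∏ i, mgf (fun ω => S.indicator (1 : ℝ → ℝ) (X i ω)) P t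
        ≤ ∏ _i : Fin n, Real.exp (ν.real S * (Real.exp t - 1)) :=
          Finset.prod_le_prod (fun i _ => mgf_nonneg) fun i _ => mgf_indicator_le hX hS t i
      _ = _ := by
        rw [Finset.prod_const, Finset.card_univ, Fintype.card_fin, ← Real.exp_nat_mul, mul_assoc]

/-- Chernoff's bound for the upper tail of the number of sample points in `S`. -/
lemma prob_le_card_le (hX : ∀ i, HasLaw (X i) ν P) (hind : iIndepFun X P) (hS : MeasurableSet S)
    {t p : ℝ} (ht0 : 0 ≤ t) (ht1 : t ≤ 1) (hp : ν.real S ≤ p) (s : ℝ) :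
    P.real {ω | s ≤ (Nat.card {i // X i ω ∈ S} : ℝ)}
      ≤ Real.exp (-(t * (s - n * p)) + n * p * t ^ 2) := by
  have := hind.isProbabilityMeasure
  obtain ⟨h1, h2⟩ := mgf_card_le hX hind hS t
  refine (measure_ge_le_exp_mul_mgf s ht0 h1).trans ?_
  refine (mul_le_mul_of_nonneg_left h2 (Real.exp_pos _).le).trans ?_
  rw [← Real.exp_add, Real.exp_le_exp]
  have h3 : Real.exp t - 1 ≤ t + t ^ 2 := by
    have := (abs_le.1 (Real.abs_exp_sub_one_sub_id_le (x := t) (by rwa [abs_of_nonneg ht0]))).2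
    linarith
  have h4 : 0 ≤ Real.exp t - 1 := by linarith [Real.add_one_le_exp t]
  have h5 : n * ν.real S * (Real.exp t - 1) ≤ n * p * (t + t ^ 2) := by
    have := (measureReal_nonneg (μ := ν) (s := S)).trans hp
    gcongr
  linarith

/-- Chernoff's bound for the lower tail of the number of sample points in `S`. -/
lemma prob_card_le_le (hX : ∀ i, HasLaw (X i) ν P) (hind : iIndepFun X P) (hS : MeasurableSet S)
    {t p : ℝ} (ht0 : 0 ≤ t) (hp0 : 0 ≤ p) (hp : p ≤ ν.real S) (s : ℝ) :
    P.real {ω | (Nat.card {i // X i ω ∈ S} : ℝ) ≤ s}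
      ≤ Real.exp (-(t * (n * p - s)) + n * p * t ^ 2 / 2) := by
  have := hind.isProbabilityMeasure
  obtain ⟨h1, h2⟩ := mgf_card_le hX hind hS (-t)
  refine (measure_le_le_exp_mul_mgf s (neg_nonpos.2 ht0) h1).trans ?_
  refine (mul_le_mul_of_nonneg_left h2 (Real.exp_pos _).le).trans ?_
  rw [← Real.exp_add, Real.exp_le_exp]
  have h3 : Real.exp (-t) ≤ 1 - t + t ^ 2 / 2 := by
    have h := Real.quadratic_le_exp_of_nonneg ht0
    have h' : Real.exp (-t) * Real.exp t = 1 := by rw [← Real.exp_add]; simp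
    have h'' : 0 ≤ 1 - t + t ^ 2 / 2 := by nlinarith [sq_nonneg (t - 1)]
    refine le_of_mul_le_mul_right ?_ (Real.exp_pos t)
    rw [h']
    refine le_trans ?_ (mul_le_mul_of_nonneg_left h h'')
    nlinarith [pow_nonneg ht0 4]
  have h4 : Real.exp (-t) - 1 ≤ 0 := by
    rw [sub_nonpos, Real.exp_le_one_iff]; linarith
  have h5 : n * ν.real S * (Real.exp (-t) - 1) ≤ n * p * (-t + t ^ 2 / 2) := by
    have h6 : n * p ≤ n * ν.real S := by gcongr
    have h7 : 0 ≤ n * p := by positivity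
    calc n * ν.real S * (Real.exp (-t) - 1) ≤ n * p * (Real.exp (-t) - 1) :=
          mul_le_mul_of_nonpos_right h6 h4
      _ ≤ _ := mul_le_mul_of_nonneg_left (by linarith) h7
  linarith

end Chernoff

/-! ### The probability integral transform -/

lemma exists_cdf_eq {ν : Measure ℝ} (hcont : Continuous (cdf ν)) {p : ℝ} (h0 : 0 < p) (h1 : p < 1) :
    ∃ t, cdf ν t = p :=
  mem_range_of_exists_le_of_exists_ge hcont
    ((tendsto_cdf_atBot ν).eventually_le_const h0).exists
    ((tendsto_cdf_atTop ν).eventually_const_le h1).exists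

lemma measurableSet_cdf_lt (ν : Measure ℝ) (p : ℝ) : MeasurableSet {x | cdf ν x < p} :=
  measurableSet_lt (monotone_cdf ν).measurable measurable_const

/-- The points whose `F`-value lies in `[p, q)`, where `F` is the distribution function of `ν`. -/
def window (ν : Measure ℝ) (p q : ℝ) : Set ℝ := {x | cdf ν x < q} \ {x | cdf ν x < p}

lemma measurableSet_window (ν : Measure ℝ) (p q : ℝ) : MeasurableSet (window ν p q) :=
  (measurableSet_cdf_lt ν q).diff (measurableSet_cdf_lt ν p)

section ProbabilityIntegralTransform

variable {ν : Measure ℝ} [IsProbabilityMeasure ν]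

lemma measureReal_Iio_eq_cdf (hcont : Continuous (cdf ν)) (t : ℝ) :
    ν.real (Set.Iio t) = cdf ν t := by
  refine le_antisymm ?_ ?_
  · rw [cdf_eq_real]; exact measureReal_mono Set.Iio_subset_Iic_self
  · have h : Tendsto (cdf ν) (nhdsWithin t (Set.Iio t)) (nhds (cdf ν t)) :=
      hcont.continuousAt.continuousWithinAt
    refine le_of_tendsto h (eventually_nhdsWithin_of_forall fun s hs => ?_)
    rw [cdf_eq_real]
    exact measureReal_mono (Set.Iic_subset_Iio.2 hs)

lemma measureReal_Ici_eq (hcont : Continuous (cdf ν)) (t : ℝ) :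
    ν.real (Set.Ici t) = 1 - cdf ν t := by
  rw [← Set.compl_Iio, probReal_compl_eq_one_sub measurableSet_Iio, measureReal_Iio_eq_cdf hcont]

lemma cdf_median (hcont : Continuous (cdf ν)) {θ : ℝ} (h : IsMedian ν θ) : cdf ν θ = 1 / 2 := by
  obtain ⟨h1, h2⟩ := h
  rw [measureReal_Ici_eq hcont] at h2
  rw [← cdf_eq_real] at h1
  linarith

/-- For continuous `F`, this and `le_measureReal_cdf_lt` say that `F(X)` is uniform on `[0, 1]`. -/
lemma measureReal_cdf_lt_le (hcont : Continuous (cdf ν)) {p : ℝ} (h0 : 0 ≤ p) :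
    ν.real {x | cdf ν x < p} ≤ p := by
  rcases h0.eq_or_lt with rfl | h0
  · have : {x | cdf ν x < 0} = ∅ := by
      ext x; simpa using cdf_nonneg ν x
    rw [this]; simp
  rcases le_or_gt 1 p with h1 | h1
  · exact measureReal_le_one.trans h1
  obtain ⟨t, ht⟩ := exists_cdf_eq hcont h0 h1
  calc ν.real {x | cdf ν x < p} ≤ ν.real (Set.Iic t) := measureReal_mono fun x hx => by
        by_contra h
        rw [Set.mem_Iic, not_le] at h
        have h2 : cdf ν x < p := hx
        linarith [monotone_cdf ν h.le]
    _ = p := by rw [← cdf_eq_real, ht]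

lemma le_measureReal_cdf_lt (hcont : Continuous (cdf ν)) {p : ℝ} (h1 : p ≤ 1) :
    p ≤ ν.real {x | cdf ν x < p} := by
  refine le_of_forall_lt_imp_le_of_dense fun q hq => ?_
  rcases le_or_gt q 0 with h0 | h0
  · exact h0.trans measureReal_nonneg
  obtain ⟨t, ht⟩ := exists_cdf_eq hcont h0 (hq.trans_le h1)
  rw [← ht, cdf_eq_real]
  refine measureReal_mono fun x hx => ?_
  exact ((monotone_cdf ν hx).trans_eq ht).trans_lt hq

lemma measureReal_window {p q : ℝ} (hpq : p ≤ q) :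
    ν.real (window ν p q) = ν.real {x | cdf ν x < q} - ν.real {x | cdf ν x < p} :=
  measureReal_sdiff (fun _ hx => lt_of_lt_of_le hx hpq) (measurableSet_cdf_lt ν p)

lemma measureReal_window_le (hcont : Continuous (cdf ν)) {p q : ℝ} (hp0 : 0 ≤ p) (hp1 : p ≤ 1)
    (hpq : p ≤ q) : ν.real (window ν p q) ≤ q - p := by
  rw [measureReal_window hpq]
  linarith [measureReal_cdf_lt_le hcont (hp0.trans hpq), le_measureReal_cdf_lt hcont hp1]

lemma le_measureReal_window (hcont : Continuous (cdf ν)) {p q : ℝ} (hp0 : 0 ≤ p) (hpq : p ≤ q)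
    (hq : q ≤ 1) : q - p ≤ ν.real (window ν p q) := by
  rw [measureReal_window hpq]
  linarith [measureReal_cdf_lt_le hcont hp0, le_measureReal_cdf_lt hcont hq]

end ProbabilityIntegralTransform


/-! ### Local behaviour of the distribution function at the median -/

section Local

variable {ν : Measure ℝ} {θ₀ M C δ η : ℝ}

/-- Below the radius `(M/(2C))^{1/δ}` the error term is at most half of the linear term. -/
lemma rpow_error_le (hM : 0 < M) (hC : 0 < C) (hδ : 0 < δ) {h : ℝ} (h0 : 0 < h)
    (hh : h ≤ (M / (2 * C)) ^ (1 / δ)) : C * h ^ (1 + δ) ≤ M * h / 2 := by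
  have h1 : h ^ δ ≤ M / (2 * C) := by
    have := Real.rpow_le_rpow h0.le hh hδ.le
    rwa [← Real.rpow_mul (by positivity), one_div_mul_cancel hδ.ne', Real.rpow_one] at this
  rw [Real.rpow_add h0, Real.rpow_one]
  rw [le_div_iff₀ (by positivity)] at h1
  nlinarith

/-- Within the radius in the definition of `ζ`, the distribution function departs from `1/2` at least
half as fast as its linearisation. The radius itself is included, by monotonicity. -/
lemma cdf_add_sub_of_le (hM : 0 < M) (hC : 0 < C) (hδ : 0 < δ) (hmed : cdf ν θ₀ = 1 / 2)
    (hF : ∀ h : ℝ, |h| < η → |cdf ν (θ₀ + h) - cdf ν θ₀ - M * h| ≤ C * |h| ^ (1 + δ))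
    {r : ℝ} (hr0 : 0 < r) (hr : r ≤ min η ((M / (2 * C)) ^ (1 / δ))) :
    1 / 2 + M * r / 2 ≤ cdf ν (θ₀ + r) ∧ cdf ν (θ₀ - r) ≤ 1 / 2 - M * r / 2 := by
  have key : ∀ h, 0 < h → h < r →
      1 / 2 + M * h / 2 ≤ cdf ν (θ₀ + r) ∧ cdf ν (θ₀ - r) ≤ 1 / 2 - M * h / 2 := by
    intro h h0 hlt
    have h1 := rpow_error_le hM hC hδ h0 (hlt.le.trans (hr.trans (min_le_right _ _)))
    have hη : h < η := hlt.trans_le (hr.trans (min_le_left _ _))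
    have h2 := hF h (by rwa [abs_of_pos h0])
    have h3 := hF (-h) (by rwa [abs_neg, abs_of_pos h0])
    rw [abs_neg, ← sub_eq_add_neg] at h3
    rw [abs_of_pos h0, hmed] at h2 h3
    have h4 := (abs_le.1 h2).1
    have h5 := (abs_le.1 h3).2
    have h6 := monotone_cdf ν (show θ₀ + h ≤ θ₀ + r by linarith)
    have h7 := monotone_cdf ν (show θ₀ - r ≤ θ₀ - h by linarith)
    constructor <;> linarith
  constructor
  · refine le_of_forall_lt_imp_le_of_dense fun y hy => ?_
    have h1 : (y - 1 / 2) * 2 / M < r := by rw [div_lt_iff₀ hM]; linarith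
    obtain ⟨h, h2, h3⟩ := exists_between (max_lt h1 hr0)
    have h4 := (key h ((le_max_right _ _).trans_lt h2) h3).1
    have h5 := (le_max_left _ _).trans_lt h2
    rw [div_lt_iff₀ hM] at h5
    linarith
  · refine le_of_forall_gt_imp_ge_of_dense fun y hy => ?_
    have h1 : (1 / 2 - y) * 2 / M < r := by rw [div_lt_iff₀ hM]; linarith
    obtain ⟨h, h2, h3⟩ := exists_between (max_lt h1 hr0)
    have h4 := (key h ((le_max_right _ _).trans_lt h2) h3).2
    have h5 := (le_max_left _ _).trans_lt h2
    rw [div_lt_iff₀ hM] at h5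
    linarith

lemma zeta_pos (hM : 0 < M) (hC : 0 < C) (hη : 0 < η) : 0 < zeta M C δ η :=
  mul_pos (by positivity) (lt_min hη (by positivity))

/-- Since `F ≤ 1`, the growth of `F` to the right of the median forces `ζ ≤ 1/2`. -/
lemma zeta_le_half (hM : 0 < M) (hC : 0 < C) (hδ : 0 < δ) (hη : 0 < η) (hmed : cdf ν θ₀ = 1 / 2)
    (hF : ∀ h : ℝ, |h| < η → |cdf ν (θ₀ + h) - cdf ν θ₀ - M * h| ≤ C * |h| ^ (1 + δ)) :
    zeta M C δ η ≤ 1 / 2 := by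
  have h1 := (cdf_add_sub_of_le hM hC hδ hmed hF
    (lt_min hη (by positivity : 0 < (M / (2 * C)) ^ (1 / δ))) le_rfl).1
  have h2 := cdf_le_one ν (θ₀ + min η ((M / (2 * C)) ^ (1 / δ)))
  unfold zeta
  linarith

end Local

/-! ### Consequences of the lower bound on the sample size -/

lemma sq_z_le {α : ℝ} (hα0 : 0 < α) (hα1 : α < 1) : z (α / 2) ^ 2 ≤ 2 * Real.log (2 / α) := by
  have h1 := z_le_sqrt (p := α / 2) (by linarith) (by linarith)
  have h0 := z_pos (p := α / 2) (by linarith) (by linarith)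
  rw [one_div_div] at h1
  have hlog : 0 ≤ Real.log (2 / α) := Real.log_nonneg (by rw [le_div_iff₀ hα0]; linarith)
  calc z (α / 2) ^ 2 ≤ √(2 * Real.log (2 / α)) ^ 2 := pow_le_pow_left₀ h0.le h1 2
    _ = _ := Real.sq_sqrt (by positivity)

/-- The numerical consequences of the lower bound on `n`. First `n ≥ 196 log (2n) ≥ 270`; feeding this
back into the logarithm gives `log n ≥ 5`, hence `n ≥ 1000`. -/
lemma sample_size_bounds {n : ℕ} {α ζ : ℝ} (hn2 : 2 ≤ n) (hα0 : 0 < α) (hα1 : α < 1)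
    (hζ0 : 0 < ζ) (hζ : ζ ≤ 1 / 2) (h : 49 * Real.log (2 * n / α) / ζ ^ 2 ≤ n) :
    1000 ≤ n ∧ Real.log n + 1 / 2 ≤ Real.log (2 * n / α) ∧ 6 ≤ Real.log n ∧
      Real.log (n + 1) ≤ n / 196 ∧ z (α / 2) ^ 2 ≤ 2 * Real.log (2 * n / α) ∧
      z (α / 2) ≤ 0.11 * √n ∧ 49 * Real.log (2 * n / α) ≤ n * ζ ^ 2 := by
  have hn2' : (2 : ℝ) ≤ n := by exact_mod_cast hn2
  have hlog2 := Real.log_two_gt_d9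
  have h1 : 49 * Real.log (2 * n / α) ≤ n * ζ ^ 2 := by rwa [div_le_iff₀ (by positivity)] at h
  have h2 : ζ ^ 2 ≤ 1 / 4 := by nlinarith
  have hL : Real.log (2 * n / α) = Real.log (2 / α) + Real.log n := by
    rw [← Real.log_mul (by positivity) (by positivity)]; congr 1; ring
  have hLα : Real.log 2 ≤ Real.log (2 / α) :=
    Real.log_le_log (by norm_num) (by rw [le_div_iff₀ hα0]; linarith)
  have hlogn : Real.log 2 ≤ Real.log n := Real.log_le_log (by norm_num) hn2'
  have h196 : 196 * Real.log (2 * n / α) ≤ n := by nlinarith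
  have he1 := Real.exp_one_lt_d9
  have he0 := Real.exp_pos 1
  have hn270 : (270 : ℝ) ≤ n := by linarith
  have hexp5 : Real.exp 5 ≤ 270 := by
    rw [show (5 : ℝ) = 5 * 1 by norm_num, show (5 : ℝ) * 1 = ((5 : ℕ) : ℝ) * 1 by norm_num,
      Real.exp_nat_mul]
    calc Real.exp 1 ^ 5 ≤ 2.7182818286 ^ 5 := pow_le_pow_left₀ he0.le he1.le 5
      _ ≤ 270 := by norm_num
  have h5 : 5 ≤ Real.log n := by
    rw [Real.le_log_iff_exp_le (by linarith)]; linarith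
  have hn1000 : (1000 : ℝ) ≤ n := by linarith
  have hexp6 : Real.exp 6 ≤ 1000 := by
    rw [show (6 : ℝ) = ((6 : ℕ) : ℝ) * 1 by norm_num, Real.exp_nat_mul]
    calc Real.exp 1 ^ 6 ≤ 2.7182818286 ^ 6 := pow_le_pow_left₀ he0.le he1.le 6
      _ ≤ 1000 := by norm_num
  have h6 : 6 ≤ Real.log n := by
    rw [Real.le_log_iff_exp_le (by linarith)]; linarith
  have hz2 := sq_z_le hα0 hα1
  refine ⟨by exact_mod_cast hn1000, by linarith, h6, ?_, by linarith, ?_, h1⟩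
  · have h7 : Real.log (n + 1) ≤ Real.log (2 * n) := Real.log_le_log (by linarith) (by linarith)
    rw [Real.log_mul (by norm_num) (by linarith)] at h7
    linarith
  · refine abs_le_of_sq_le_sq' ?_ (by positivity) |>.2
    rw [mul_pow, Real.sq_sqrt (by linarith)]
    linarith

/-! ### Events of small probability -/

section Events

variable {Ω : Type*} [MeasurableSpace Ω] {P : Measure Ω}
  {ν : Measure ℝ} [IsProbabilityMeasure ν] {n : ℕ} {X : Fin n → Ω → ℝ}

lemma exp_neg_mul_log {n : ℕ} (hn : 0 < n) (j : ℕ) :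
    Real.exp (-(j * Real.log n)) = 1 / (n : ℝ) ^ j := by
  have hn' : (0 : ℝ) < n := by exact_mod_cast hn
  rw [Real.exp_neg, Real.exp_nat_mul, Real.exp_log hn', one_div]

/-- A set whose mass falls short of `1/2` by `7ε`, with `ε = √(L/n)`, is unlikely to contain `k` sample
points. -/
lemma prob_half_line_le (hX : ∀ i, HasLaw (X i) ν P) (hind : iIndepFun X P) {S : Set ℝ}
    (hS : MeasurableSet S) {k : ℕ} {L q : ℝ} (hn : 1000 ≤ n)
    (hL : Real.log n ≤ L) (hlog : 6 ≤ Real.log n) (hz : q ^ 2 ≤ 2 * L)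
    (hk : (n : ℝ) - 2 * k ≤ q * √n + 3) (hε : 7 * √(L / n) ≤ 1 / 2)
    (hνS : ν.real S ≤ 1 / 2 - 7 * √(L / n)) :
    P.real {ω | (k : ℝ) ≤ (Nat.card {i // X i ω ∈ S} : ℝ)} ≤ 1 / (n : ℝ) ^ 2 := by
  have hn' : (1000 : ℝ) ≤ n := by exact_mod_cast hn
  set ε := √(L / n) with hεdef
  have hε0 : 0 ≤ ε := Real.sqrt_nonneg _
  have hε2 : n * ε ^ 2 = L := by
    rw [hεdef, Real.sq_sqrt (div_nonneg (by linarith) (by linarith))]; field_simp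
  have hW : q * √n ≤ 3 / 2 * (ε * n) := by
    refine abs_le_of_sq_le_sq' ?_ (by positivity) |>.2
    rw [mul_pow, Real.sq_sqrt (by linarith), mul_pow, mul_pow]
    nlinarith
  refine (prob_le_card_le hX hind hS hε0 (by linarith) hνS k).trans ?_
  rw [← exp_neg_mul_log (by omega), Real.exp_le_exp]
  push_cast
  have h1 : 6 * (ε * n) - 3 / 2 ≤ k - n * (1 / 2 - 7 * ε) := by nlinarith
  have h2 := mul_le_mul_of_nonneg_left h1 hε0
  have h3 : n * (1 / 2 - 7 * ε) * ε ^ 2 ≤ n * (1 / 2) * ε ^ 2 := by gcongr; linarith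
  nlinarith

/-- The `F`-windows of length `d/n` starting at the multiples of `1/n`, with `d` below `D` by
`w (q + 4 log n)`, where `w = n^{1/4}`, are unlikely to contain `D + 2` sample points. -/
lemma prob_exists_window_ge (hcont : Continuous (cdf ν)) (hX : ∀ i, HasLaw (X i) ν P)
    (hind : iIndepFun X P) {D w q d : ℝ} (hn : 1000 ≤ n) (hw0 : 5 ≤ w) (hw : w ^ 2 = √n)
    (hlog : 6 ≤ Real.log n) (hq : 0 ≤ q) (hD0 : 0 ≤ D) (hD : D ≤ q * √n + 3)
    (hd : d = D - w * (q + 4 * Real.log n)) :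
    P.real (⋃ a ∈ Finset.range (n + 1),
      {ω | D + 2 ≤ (Nat.card {i // X i ω ∈ window ν (a / n) ((a + d) / n)} : ℝ)})
      ≤ (n + 1) * (1 / (n : ℝ) ^ 3) := by
  have := hind.isProbabilityMeasure
  have hn' : (1000 : ℝ) ≤ n := by exact_mod_cast hn
  refine (measureReal_biUnion_finset_le _ _).trans ?_
  have hone : ∀ a ∈ Finset.range (n + 1), P.real
      {ω | D + 2 ≤ (Nat.card {i // X i ω ∈ window ν (a / n) ((a + d) / n)} : ℝ)}
      ≤ 1 / (n : ℝ) ^ 3 := by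
    intro a ha
    have ha' : (a : ℝ) ≤ n := by
      have := Finset.mem_range.1 ha
      exact_mod_cast (by omega)
    -- for `d < 0` the window is empty, and the event is impossible because `D + 2 > 0`
    rcases lt_or_ge d 0 with hd0 | hd0
    · have hempty : window ν (a / n) ((a + d) / n) = ∅ := by
        rw [window, Set.sdiff_eq_empty]
        intro x hx
        refine lt_trans (show cdf ν x < (a + d) / n from hx) ?_
        gcongr; linarith
      have : {ω | D + 2 ≤ (Nat.card {i // X i ω ∈ window ν (a / n) ((a + d) / n)} : ℝ)} = ∅ := by
        ext ω
        simp only [hempty, Set.mem_ofPred_eq, Set.mem_empty_iff_false, iff_false, not_le]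
        simp
        linarith
      rw [this, measureReal_empty]
      positivity
    have hS : ν.real (window ν (a / n) ((a + d) / n)) ≤ d / n := by
      refine (measureReal_window_le hcont (by positivity) ((div_le_one (by linarith)).2 ha')
        (by gcongr; linarith)).trans (le_of_eq ?_)
      ring
    refine (prob_le_card_le hX hind (measurableSet_window ν _ _) (t := 1 / w) (by positivity)
      (by rw [div_le_one (by linarith)]; linarith) hS (D + 2)).trans ?_
    rw [← exp_neg_mul_log (by omega), Real.exp_le_exp, mul_div_cancel₀ _ (by linarith)]
    have h1 : d * (1 / w) ^ 2 ≤ q + 1 := by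
      rw [one_div, inv_pow, ← div_eq_mul_inv, div_le_iff₀ (by positivity)]
      have : 0 ≤ w * (q + 4 * Real.log n) := by positivity
      nlinarith
    have h2 : 1 / w * (D + 2 - d) = q + 4 * Real.log n + 2 / w := by
      rw [hd]; field_simp; ring
    have h3 : 0 ≤ 2 / w := by positivity
    rw [h2]
    push_cast
    linarith
  refine (Finset.sum_le_sum hone).trans (le_of_eq ?_)
  rw [Finset.sum_const, Finset.card_range, nsmul_eq_mul]
  push_cast
  ring

/-- The `F`-windows inside `[0, 1]` of length `d/n` starting at the multiples of `1/n`, with `d` above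
`D` by `w (q + 13 log n)`, where `w = n^{1/4}`, are unlikely to contain at most `D` sample points. -/
lemma prob_exists_window_le (hcont : Continuous (cdf ν)) (hX : ∀ i, HasLaw (X i) ν P)
    (hind : iIndepFun X P) {D w q d : ℝ} (hn : 1000 ≤ n) (hw0 : 5 ≤ w) (hw : w ^ 2 = √n)
    (hlog : 6 ≤ Real.log n) (hq : 0 ≤ q) (hD0 : 0 ≤ D) (hD : D ≤ q * √n + 3)
    (hd : d = D + w * (q + 13 * Real.log n)) :
    P.real (⋃ a ∈ Finset.range (n + 1), {ω | a + d ≤ n ∧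
      (Nat.card {i // X i ω ∈ window ν (a / n) ((a + d) / n)} : ℝ) ≤ D})
      ≤ (n + 1) * (1 / (n : ℝ) ^ 3) := by
  have := hind.isProbabilityMeasure
  have hn' : (1000 : ℝ) ≤ n := by exact_mod_cast hn
  have hd0 : 0 ≤ d := by rw [hd]; positivity
  refine (measureReal_biUnion_finset_le _ _).trans ?_
  have hone : ∀ a ∈ Finset.range (n + 1), P.real {ω | a + d ≤ n ∧
      (Nat.card {i // X i ω ∈ window ν (a / n) ((a + d) / n)} : ℝ) ≤ D} ≤ 1 / (n : ℝ) ^ 3 := by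
    intro a ha
    by_cases had : a + d ≤ n
    swap
    · simp only [had, false_and]
      simp
    have hS : d / n ≤ ν.real (window ν (a / n) ((a + d) / n)) := by
      refine le_trans (le_of_eq ?_) (le_measureReal_window hcont (by positivity)
        (by gcongr; linarith) ((div_le_one (by linarith)).2 had))
      ring
    refine (measureReal_mono fun ω hω => hω.2).trans
      ((prob_card_le_le hX hind (measurableSet_window ν _ _) (t := 1 / w) (by positivity)
      (by positivity) hS D).trans ?_)
    rw [← exp_neg_mul_log (by omega), Real.exp_le_exp, mul_div_cancel₀ _ (by linarith)]
    have h1 : d * (1 / w) ^ 2 ≤ q + 1 + (q + 13 * Real.log n) / 5 := by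
      rw [one_div, inv_pow, ← div_eq_mul_inv, div_le_iff₀ (by positivity), hd]
      have : 5 * (w * (q + 13 * Real.log n)) ≤ w ^ 2 * (q + 13 * Real.log n) := by
        rw [sq, mul_assoc]
        exact mul_le_mul_of_nonneg_right hw0 (by positivity)
      nlinarith
    have h2 : 1 / w * (d - D) = q + 13 * Real.log n := by
      rw [hd]; field_simp; ring
    rw [h2]
    push_cast
    linarith
  refine (Finset.sum_le_sum hone).trans (le_of_eq ?_)
  rw [Finset.sum_const, Finset.card_range, nsmul_eq_mul]
  push_cast
  ring

end Events


/-! ### The width of the interval -/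

section Width

variable {ν : Measure ℝ} {n : ℕ}

/-- Bounds on the `F`-mass of `[lo, hi]` from the counts in the windows. -/
lemma abs_gap_sub_le {x : Fin n → ℝ} {k : ℕ} {lo hi w q d₁ d₂ : ℝ} (hn : 1000 ≤ n)
    (hw0 : 5 ≤ w) (hq : 0 ≤ q) (hlog : 6 ≤ Real.log n)
    (hle : lo ≤ hi) (hD0 : 0 ≤ (n : ℝ) - 2 * k)
    (hDu : (n : ℝ) - 2 * k ≤ q * √n + 3)
    (hDl : q * √n - q ^ 2 / 4 - 4 ≤ (n : ℝ) - 2 * k)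
    (hin : ∀ S : Set ℝ, S ⊆ Set.Ioo lo hi → lo < hi → Nat.card {i // x i ∈ S} + 2 * k ≤ n)
    (hout : ∀ S : Set ℝ, Set.Icc lo hi ⊆ S → n + 2 ≤ Nat.card {i // x i ∈ S} + 2 * k)
    (hd₁ : d₁ = (n : ℝ) - 2 * k - w * (q + 4 * Real.log n))
    (hd₂ : d₂ = (n : ℝ) - 2 * k + w * (q + 13 * Real.log n))
    (h₁ : ∀ a ∈ Finset.range (n + 1), (Nat.card {i // x i ∈ window ν (a / n) ((a + d₁) / n)} : ℝ)
      < (n : ℝ) - 2 * k + 2)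
    (h₂ : ∀ a ∈ Finset.range (n + 1), a + d₂ ≤ n →
      (n : ℝ) - 2 * k < Nat.card {i // x i ∈ window ν (a / n) ((a + d₂) / n)}) :
    |n * (cdf ν hi - cdf ν lo) - q * √n| ≤ w * (q + 14 * Real.log n) + q ^ 2 / 4 := by
  have hn' : (0 : ℝ) < n := by exact_mod_cast (by omega)
  have hlo0 := cdf_nonneg ν lo
  have hlo1 := cdf_le_one ν lo
  have hhi1 := cdf_le_one ν hi
  have hmono := monotone_cdf ν hle
  have hfloor := Nat.floor_le (show 0 ≤ n * cdf ν lo by positivity)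
  have hfloor' := Nat.lt_floor_add_one (n * cdf ν lo)
  set a := ⌊n * cdf ν lo⌋₊ with ha
  have hwl : 30 ≤ w * Real.log n := by nlinarith
  have hq2 : 0 ≤ q ^ 2 := sq_nonneg q
  -- the window of length `d₁ / n` that starts at `a / n` covers `[lo, hi]` if the gap is too small
  have lower : d₁ - 1 ≤ n * (cdf ν hi - cdf ν lo) := by
    by_contra! hlt
    have han : a ∈ Finset.range (n + 1) := by
      rw [Finset.mem_range]
      have : (a : ℝ) < n + 1 := by nlinarith
      exact_mod_cast this
    have hcount := hout (window ν (a / n) ((a + d₁) / n)) fun y hy => by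
      refine ⟨?_, ?_⟩
      · change cdf ν y < _
        refine (monotone_cdf ν hy.2).trans_lt ?_
        rw [lt_div_iff₀ hn']; linarith
      · change ¬ cdf ν y < _
        rw [not_lt, div_le_iff₀ hn']
        have := monotone_cdf ν hy.1
        nlinarith
    have hcount' : (n : ℝ) + 2
        ≤ (Nat.card {i // x i ∈ window ν (a / n) ((a + d₁) / n)} : ℝ) + 2 * k := by
      exact_mod_cast hcount
    linarith [h₁ a han]
  -- the window of length `d₂ / n` that starts at `(a + 1) / n` lies in `(lo, hi)` if the gap is too
  -- large
  have upper : n * (cdf ν hi - cdf ν lo) ≤ d₂ + 1 := by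
    by_contra! hlt
    have hd0 : 0 ≤ d₂ := by rw [hd₂]; positivity
    have hlohi : lo < hi := by
      refine hle.lt_of_ne fun h => ?_
      rw [h, sub_self, mul_zero] at hlt
      linarith
    have hb : ((a + 1 : ℕ) : ℝ) + d₂ < n * cdf ν hi := by push_cast; linarith
    have hbn : ((a + 1 : ℕ) : ℝ) + d₂ ≤ n := hb.le.trans (by nlinarith)
    have han : a + 1 ∈ Finset.range (n + 1) := by
      rw [Finset.mem_range]
      have : ((a + 1 : ℕ) : ℝ) < n + 1 := by linarith
      exact_mod_cast this
    have hcount := hin (window ν ((a + 1 : ℕ) / n) (((a + 1 : ℕ) + d₂) / n)) (fun y hy => by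
      have hy1 : cdf ν y < ((a + 1 : ℕ) + d₂) / n := hy.1
      have hy2 : ((a + 1 : ℕ) : ℝ) / n ≤ cdf ν y := not_lt.1 hy.2
      rw [lt_div_iff₀ hn'] at hy1
      rw [div_le_iff₀ hn'] at hy2
      push_cast at hy2
      refine ⟨?_, ?_⟩ <;> by_contra! hcon <;> have := monotone_cdf ν hcon <;> nlinarith) hlohi
    have hcount' : (Nat.card {i // x i ∈ window ν ((a + 1 : ℕ) / n) (((a + 1 : ℕ) + d₂) / n)} : ℝ)
        + 2 * k ≤ n := by exact_mod_cast hcount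
    linarith [h₂ (a + 1) han hbn]
  rw [abs_le]
  constructor <;> nlinarith

/-- The deterministic part of the argument: the width is controlled by the `F`-mass of the interval
and the linearisation of `F` at the median. -/
lemma abs_width_sub_le {M C δ η θ₀ α lo hi : ℝ} {w : ℝ} (hn : 0 < n) (hM : 0 < M)
    (hC : 0 < C) (hδ : 0 < δ) (hα0 : 0 < α) (hα1 : α < 1)
    (hF : ∀ h : ℝ, |h| < η → |cdf ν (θ₀ + h) - cdf ν θ₀ - M * h| ≤ C * |h| ^ (1 + δ))
    (hw : w = (n : ℝ) ^ (1 / 4 : ℝ)) (hL : 0 ≤ Real.log (2 * n / α))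
    (hr : 14 * √(Real.log (2 * n / α) / n) / M ≤ η)
    (hlo : θ₀ - 14 * √(Real.log (2 * n / α) / n) / M < lo) (hle : lo ≤ hi)
    (hhi : hi < θ₀ + 14 * √(Real.log (2 * n / α) / n) / M)
    (hgap : |n * (cdf ν hi - cdf ν lo) - z (α / 2) * √n|
      ≤ w * (z (α / 2) + 14 * Real.log n) + z (α / 2) ^ 2 / 4) :
    |√n * M / z (α / 2) * (hi - lo) - 1| ≤ bound M C δ α n := by
  have hn' : (0 : ℝ) < n := by exact_mod_cast hn
  have hs : 0 < √(n : ℝ) := Real.sqrt_pos.2 hn'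
  have hsq : √(n : ℝ) ^ 2 = n := Real.sq_sqrt hn'.le
  have hz2 := sq_z_le hα0 hα1
  have hz0 : 0 < z (α / 2) := z_pos (by linarith) (by linarith)
  have hw0 : 0 < w := by rw [hw]; positivity
  have hww : w ^ 2 = √n := by
    rw [hw, ← Real.rpow_natCast, ← Real.rpow_mul hn'.le, Real.sqrt_eq_rpow]; norm_num
  set zα := z (α / 2) with hzα
  set L := Real.log (2 * n / α) with hLdef
  set r := 14 * √(L / n) / M with hrdef
  have hr0 : 0 ≤ r := by positivity
  -- linearisation at the two end points
  have hlin : ∀ t, θ₀ - r < t → t < θ₀ + r →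
      |cdf ν t - cdf ν θ₀ - M * (t - θ₀)| ≤ C * r ^ (1 + δ) := by
    intro t h1 h2
    have habs : |t - θ₀| < r := abs_lt.2 ⟨by linarith, by linarith⟩
    have := hF (t - θ₀) (habs.trans_le hr)
    rw [show θ₀ + (t - θ₀) = t by ring] at this
    exact this.trans (by gcongr)
  have h1 := hlin lo hlo (hle.trans_lt hhi)
  have h2 := hlin hi (hlo.trans_le hle) hhi
  have h3 : |M * (hi - lo) - (cdf ν hi - cdf ν lo)| ≤ 2 * (C * r ^ (1 + δ)) := by
    rw [abs_le] at *
    constructor <;> linarith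
  have hrpow : √n / zα * (2 * (C * r ^ (1 + δ))) =
      2 * C * 14 ^ (1 + δ) * L ^ ((1 + δ) / 2) / (zα * M ^ (1 + δ) * (n : ℝ) ^ (δ / 2)) := by
    have e1 : √(L / n) ^ (1 + δ) = L ^ ((1 + δ) / 2) / (√n * (n : ℝ) ^ (δ / 2)) := by
      rw [Real.sqrt_eq_rpow, ← Real.rpow_mul (by positivity), Real.div_rpow hL hn'.le,
        Real.sqrt_eq_rpow, ← Real.rpow_add hn']
      congr 2 <;> ring
    rw [hrdef, Real.div_rpow (by positivity) hM.le, Real.mul_rpow (by norm_num) (by positivity), e1]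
    field_simp
  have h4 : |√n / zα * (M * (hi - lo) - (cdf ν hi - cdf ν lo))|
      ≤ 2 * C * 14 ^ (1 + δ) * L ^ ((1 + δ) / 2) / (zα * M ^ (1 + δ) * (n : ℝ) ^ (δ / 2)) := by
    rw [← hrpow, abs_mul, abs_of_pos (by positivity : 0 < √n / zα)]
    gcongr
  have h5 : |√n / zα * (cdf ν hi - cdf ν lo) - 1|
      ≤ (1 + 14 * Real.log n / zα) / w + √(Real.log (2 / α) / (8 * n)) := by
    have e1 : √n / zα * (cdf ν hi - cdf ν lo) - 1
        = (n * (cdf ν hi - cdf ν lo) - zα * √n) / (zα * √n) := by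
      have : √n / zα * (cdf ν hi - cdf ν lo) = (√n ^ 2 * (cdf ν hi - cdf ν lo)) / (zα * √n) := by
        field_simp
      rw [sub_div, div_self (by positivity), this, hsq]
    have e2 : zα / (4 * √n) ≤ √(Real.log (2 / α) / (8 * n)) := by
      refine Real.le_sqrt_of_sq_le ?_
      rw [div_pow, mul_pow, hsq, div_le_div_iff₀ (by positivity) (by positivity)]
      nlinarith
    rw [e1, abs_div, abs_of_pos (by positivity : 0 < zα * √n), div_le_iff₀ (by positivity)]
    refine hgap.trans ?_
    have e3 : (1 + 14 * Real.log n / zα) / w * (zα * √n) = w * (zα + 14 * Real.log n) := by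
      rw [← hww]; field_simp
    have e4 : zα / (4 * √n) * (zα * √n) = zα ^ 2 / 4 := by field_simp
    rw [add_mul, e3, ← e4]
    gcongr
  have h6 : √n * M / zα * (hi - lo) - 1 = √n / zα * (M * (hi - lo) - (cdf ν hi - cdf ν lo))
      + (√n / zα * (cdf ν hi - cdf ν lo) - 1) := by ring
  rw [h6]
  refine (abs_add_le _ _).trans ?_
  unfold bound
  rw [← hw]
  linarith

end Width

/-! ### The finite-sample bound -/

/-- The finite-sample part of the theorem. -/
theorem prob_width_bound {Ω : Type*} [MeasurableSpace Ω] {P : Measure Ω} [IsProbabilityMeasure P]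
    {ν : Measure ℝ} [IsProbabilityMeasure ν] {θ₀ M C δ η : ℝ}
    (hM : 0 < M) (hC : 0 < C) (hδ : 0 < δ) (hη : 0 < η)
    (hcont : Continuous (cdf ν)) (hmed : IsMedian ν θ₀)
    (hF : ∀ h : ℝ, |h| < η → |cdf ν (θ₀ + h) - cdf ν θ₀ - M * h| ≤ C * |h| ^ (1 + δ))
    {n : ℕ} (hn2 : 2 ≤ n) {α : ℝ} (hα0 : 0 < α) (hα1 : α < 1)
    (hlogb : Real.logb 2 (2 / α) ≤ n)
    (hsize : 49 * Real.log (2 * n / α) / zeta M C δ η ^ 2 ≤ n)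
    {X : Fin n → Ω → ℝ} (hX : ∀ i, HasLaw (X i) ν P) (hind : iIndepFun X P) :
    1 - 6 / (n : ℝ) ^ 2 ≤
      P.real {ω | Bornology.IsBounded (CI α (fun i => X i ω)) ∧
        |√n * M / z (α / 2) * width (CI α (fun i => X i ω)) - 1| ≤ bound M C δ α n} := by
  have hF0 := cdf_median hcont hmed
  have hζ0 : 0 < zeta M C δ η := zeta_pos hM hC hη
  have hζ := zeta_le_half hM hC hδ hη hF0 hF
  obtain ⟨hn, hLn, hlog, hlog1, hzL, hzn, hsize'⟩ :=
    sample_size_bounds hn2 hα0 hα1 hζ0 hζ hsize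
  obtain ⟨k, hck, hk1, hk2⟩ := exists_rank n hα0 hα1
  obtain ⟨hk, hkn, hDu, hDl⟩ := rank_bounds hα0 hα1 hn hlog1 hlogb hzn hk1 hk2
  have hn1 : (1000 : ℝ) ≤ n := by exact_mod_cast hn
  have hn' : (0 : ℝ) < n := by linarith
  set L := Real.log (2 * n / α) with hL
  set q := z (α / 2) with hq
  have hq0 : 0 < q := z_pos (by linarith) (by linarith)
  set ε := √(L / n) with hε
  have hε0 : 0 < ε := Real.sqrt_pos.2 (div_pos (by linarith) hn')
  have hεζ : 7 * ε ≤ zeta M C δ η := by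
    refine abs_le_of_sq_le_sq' ?_ hζ0.le |>.2
    rw [mul_pow, hε, Real.sq_sqrt (div_nonneg (by linarith) hn'.le), ← mul_div_assoc,
      div_le_iff₀ hn']
    linarith
  set r := 14 * ε / M with hr
  have hr0 : 0 < r := by positivity
  have hrmin : r ≤ min η ((M / (2 * C)) ^ (1 / δ)) := by
    rw [hr, div_le_iff₀ hM]
    unfold zeta at hεζ
    linarith
  obtain ⟨hFr, hFl⟩ := cdf_add_sub_of_le hM hC hδ hF0 hF hr0 hrmin
  have hMr : M * r / 2 = 7 * ε := by rw [hr]; field_simp; ring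
  rw [hMr] at hFr hFl
  set w := (n : ℝ) ^ (1 / 4 : ℝ) with hw
  have hww : w ^ 2 = √n := by
    rw [hw, ← Real.rpow_natCast, ← Real.rpow_mul hn'.le, Real.sqrt_eq_rpow]; norm_num
  have hw5 : 5 ≤ w := by
    refine abs_le_of_sq_le_sq' ?_ (by positivity) |>.2
    rw [hww]
    exact Real.le_sqrt_of_sq_le (by linarith)
  have hkn' : (0 : ℝ) ≤ n - 2 * k := by
    have : 2 * (k : ℝ) ≤ n := by exact_mod_cast hkn
    linarith
  set d₁ := (n : ℝ) - 2 * k - w * (q + 4 * Real.log n) with hd₁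
  set d₂ := (n : ℝ) - 2 * k + w * (q + 13 * Real.log n) with hd₂
  -- the four exceptional events
  set A₁ := {ω | (k : ℝ) ≤ (Nat.card {i // X i ω ∈ Set.Iic (θ₀ - r)} : ℝ)} with hA₁
  set A₂ := {ω | (k : ℝ) ≤ (Nat.card {i // X i ω ∈ Set.Ici (θ₀ + r)} : ℝ)} with hA₂
  set A₃ := ⋃ a ∈ Finset.range (n + 1), {ω | (n : ℝ) - 2 * k + 2 ≤
    (Nat.card {i // X i ω ∈ window ν (a / n) ((a + d₁) / n)} : ℝ)} with hA₃
  set A₄ := ⋃ a ∈ Finset.range (n + 1), {ω | a + d₂ ≤ n ∧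
    (Nat.card {i // X i ω ∈ window ν (a / n) ((a + d₂) / n)} : ℝ) ≤ n - 2 * k} with hA₄
  have hP₁ : P.real A₁ ≤ 1 / (n : ℝ) ^ 2 :=
    prob_half_line_le hX hind measurableSet_Iic hn (by linarith) hlog hzL hDu (by linarith)
      (by rw [← cdf_eq_real]; exact hFl)
  have hP₂ : P.real A₂ ≤ 1 / (n : ℝ) ^ 2 :=
    prob_half_line_le hX hind measurableSet_Ici hn (by linarith) hlog hzL hDu (by linarith)
      (by rw [measureReal_Ici_eq hcont]; linarith)
  have hP₃ : P.real A₃ ≤ (n + 1) * (1 / (n : ℝ) ^ 3) :=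
    prob_exists_window_ge hcont hX hind hn hw5 hww hlog hq0.le hkn' hDu hd₁
  have hP₄ : P.real A₄ ≤ (n + 1) * (1 / (n : ℝ) ^ 3) :=
    prob_exists_window_le hcont hX hind hn hw5 hww hlog hq0.le hkn' hDu hd₂
  set G := {ω | Bornology.IsBounded (CI α (fun i => X i ω)) ∧
    |√n * M / q * width (CI α (fun i => X i ω)) - 1| ≤ bound M C δ α n} with hG
  have hsub : Set.univ ⊆ G ∪ (A₁ ∪ A₂ ∪ (A₃ ∪ A₄)) := by
    intro ω _
    by_cases hbad : ω ∈ A₁ ∪ A₂ ∪ (A₃ ∪ A₄)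
    · exact Or.inr hbad
    refine Or.inl ?_
    simp only [Set.mem_union, not_or] at hbad
    obtain ⟨⟨h1, h2⟩, h3, h4⟩ := hbad
    simp only [hA₁, hA₂, hA₃, hA₄, Set.mem_ofPred_eq, Set.mem_iUnion, not_le, not_exists, not_and,
      Nat.cast_lt] at h1 h2 h3 h4
    obtain ⟨lo, hi, hle, hCI, hlo, hhi, hin, hout⟩ :=
      exists_CI_eq_Icc (fun i => X i ω) hck hk hkn
    have hgap := abs_gap_sub_le hn hw5 hq0.le hlog hle hkn' hDu hDl hin hout hd₁ hd₂ h3 h4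
    refine ⟨by rw [hCI]; exact Metric.isBounded_Icc lo hi, ?_⟩
    rw [hCI, width, Real.diam_Icc hle]
    exact abs_width_sub_le (by omega) hM hC hδ hα0 hα1 hF hw (by linarith)
      (hrmin.trans (min_le_left _ _)) (hlo _ h1) hle (hhi _ h2) hgap
  have htotal : 1 ≤ P.real G + (P.real A₁ + P.real A₂ + (P.real A₃ + P.real A₄)) := by
    rw [← probReal_univ (μ := P)]
    refine (measureReal_mono hsub).trans ((measureReal_union_le _ _).trans ?_)
    gcongr
    refine (measureReal_union_le _ _).trans ?_
    gcongr <;> exact measureReal_union_le _ _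
  have hsum : (n + 1) * (1 / (n : ℝ) ^ 3) ≤ 2 / (n : ℝ) ^ 2 := by
    rw [mul_one_div, div_le_div_iff₀ (by positivity) (by positivity)]
    have : 0 ≤ (n : ℝ) ^ 2 := by positivity
    nlinarith
  have h6 : 6 / (n : ℝ) ^ 2
      = 1 / (n : ℝ) ^ 2 + 1 / (n : ℝ) ^ 2 + (2 / (n : ℝ) ^ 2 + 2 / (n : ℝ) ^ 2) := by
    ring
  rw [h6]
  linarith


/-! ### The order of the bound -/

/-- For fixed `α`, `log (2n/α)` lies between `log n` and `2 log n` for all large `n`. -/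
lemma eventually_log_bounds {α : ℝ} (hα0 : 0 < α) (hα1 : α < 1) :
    ∀ᶠ n : ℕ in atTop, 1 ≤ Real.log n ∧ Real.log n ≤ Real.log (2 * n / α) ∧
      Real.log (2 * n / α) ≤ 2 * Real.log n := by
  have h1 : ∀ᶠ n : ℕ in atTop, 1 ≤ Real.log n :=
    (Real.tendsto_log_atTop.comp tendsto_natCast_atTop_atTop).eventually_ge_atTop 1
  have h2 : ∀ᶠ n : ℕ in atTop, Real.log (2 / α) ≤ Real.log n :=
    (Real.tendsto_log_atTop.comp tendsto_natCast_atTop_atTop).eventually_ge_atTop _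
  filter_upwards [h1, h2, eventually_gt_atTop 0] with n h1 h2 h3
  have hn : (0 : ℝ) < n := by exact_mod_cast h3
  have hL : Real.log (2 * n / α) = Real.log (2 / α) + Real.log n := by
    rw [← Real.log_mul (by positivity) hn.ne']; congr 1; ring
  have h0 : 0 ≤ Real.log (2 / α) := Real.log_nonneg (by rw [le_div_iff₀ hα0]; linarith)
  exact ⟨h1, by linarith, by linarith⟩

theorem bound_isTheta {M C δ α : ℝ} (hM : 0 < M) (hC : 0 < C) (hδ : 0 < δ) (hα0 : 0 < α)
    (hα1 : α < 1) :
    (fun n : ℕ => bound M C δ α n) =Θ[atTop]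
      (fun n : ℕ => Real.log n * (n : ℝ) ^ (-(1 / 4) : ℝ)
        + Real.log n ^ ((1 + δ) / 2) * (n : ℝ) ^ (-(δ / 2))) := by
  have hz0 : 0 < z (α / 2) := z_pos (by linarith) (by linarith)
  set q := z (α / 2) with hq
  have hlα : 0 ≤ Real.log (2 / α) := Real.log_nonneg (by rw [le_div_iff₀ hα0]; linarith)
  set a₁ : ℝ := 14 / q with ha₁
  set a₂ : ℝ := √(Real.log (2 / α) / 8) with ha₂
  set a₃ : ℝ := 2 * C * 14 ^ (1 + δ) / (q * M ^ (1 + δ)) with ha₃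
  have h₁ : 0 < a₁ := by positivity
  have h₂ : 0 ≤ a₂ := Real.sqrt_nonneg _
  have h₃ : 0 < a₃ := by positivity
  -- the bound with negative powers of `n` and named constants
  have hrw : ∀ n : ℕ, 0 < n → bound M C δ α n =
      (1 + a₁ * Real.log n) * (n : ℝ) ^ (-(1 / 4) : ℝ) + a₂ * (n : ℝ) ^ (-(1 / 2) : ℝ)
        + a₃ * (Real.log (2 * n / α) ^ ((1 + δ) / 2) * (n : ℝ) ^ (-(δ / 2))) := by
    intro n hn
    have hn' : (0 : ℝ) < n := by exact_mod_cast hn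
    unfold bound
    rw [← hq, ← div_div, Real.sqrt_div (by positivity), Real.rpow_neg hn'.le, Real.rpow_neg hn'.le,
      Real.rpow_neg hn'.le, ← Real.sqrt_eq_rpow, ha₁, ha₂, ha₃]
    field_simp
  refine ⟨IsBigO.of_bound (1 + a₁ + a₂ + a₃ * 2 ^ ((1 + δ) / 2)) ?_,
    IsBigO.of_bound (1 / a₁ + 1 / a₃) ?_⟩
  · filter_upwards [eventually_log_bounds hα0 hα1, eventually_gt_atTop 0] with n ⟨hl1, hl2, hl3⟩ hn
    have hn' : (1 : ℝ) ≤ n := by exact_mod_cast hn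
    rw [hrw n hn]
    set ℓ := Real.log n
    set L := Real.log (2 * n / α)
    have hpow : L ^ ((1 + δ) / 2) ≤ 2 ^ ((1 + δ) / 2) * ℓ ^ ((1 + δ) / 2) := by
      rw [← Real.mul_rpow (by norm_num) (by linarith)]
      gcongr
      linarith
    have hhalf : (n : ℝ) ^ (-(1 / 2) : ℝ) ≤ (n : ℝ) ^ (-(1 / 4) : ℝ) :=
      Real.rpow_le_rpow_of_exponent_le hn' (by norm_num)
    have hu : 0 < (n : ℝ) ^ (-(1 / 4) : ℝ) := by positivity
    have hv : 0 < (n : ℝ) ^ (-(δ / 2)) := by positivity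
    have hL0 : 0 < L := by linarith
    have hℓ0 : 0 < ℓ := by linarith
    rw [Real.norm_of_nonneg (by positivity), Real.norm_of_nonneg (by positivity)]
    set u := (n : ℝ) ^ (-(1 / 4) : ℝ)
    set v := (n : ℝ) ^ (-(δ / 2))
    have hA : 0 < ℓ * u := by positivity
    have hB : 0 < ℓ ^ ((1 + δ) / 2) * v := by positivity
    have e1 : (1 + a₁ * ℓ) * u ≤ (1 + a₁) * (ℓ * u) := by nlinarith
    have e2 : a₂ * (n : ℝ) ^ (-(1 / 2) : ℝ) ≤ a₂ * (ℓ * u) := by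
      gcongr; nlinarith
    have e3 : a₃ * (L ^ ((1 + δ) / 2) * v)
        ≤ a₃ * 2 ^ ((1 + δ) / 2) * (ℓ ^ ((1 + δ) / 2) * v) := by
      rw [mul_assoc a₃, ← mul_assoc (2 ^ ((1 + δ) / 2) : ℝ)]; gcongr
    have hc : 0 ≤ a₃ * (2 : ℝ) ^ ((1 + δ) / 2) := by positivity
    have e4 : 0 ≤ a₃ * 2 ^ ((1 + δ) / 2) * (ℓ * u) := by positivity
    have e5 : 0 ≤ (1 + a₁ + a₂) * (ℓ ^ ((1 + δ) / 2) * v) := by positivity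
    linarith
  · filter_upwards [eventually_log_bounds hα0 hα1, eventually_gt_atTop 0] with n ⟨hl1, hl2, hl3⟩ hn
    have hn' : (1 : ℝ) ≤ n := by exact_mod_cast hn
    rw [hrw n hn]
    set ℓ := Real.log n
    set L := Real.log (2 * n / α)
    have hL0 : 0 < L := by linarith
    have hℓ0 : 0 < ℓ := by linarith
    have hpow : ℓ ^ ((1 + δ) / 2) ≤ L ^ ((1 + δ) / 2) := by gcongr
    have hu : 0 < (n : ℝ) ^ (-(1 / 4) : ℝ) := by positivity
    have hv : 0 < (n : ℝ) ^ (-(δ / 2)) := by positivity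
    have ht : 0 < (n : ℝ) ^ (-(1 / 2) : ℝ) := by positivity
    rw [Real.norm_of_nonneg (by positivity), Real.norm_of_nonneg (by positivity)]
    set u := (n : ℝ) ^ (-(1 / 4) : ℝ)
    set v := (n : ℝ) ^ (-(δ / 2))
    set s := (n : ℝ) ^ (-(1 / 2) : ℝ)
    set W := (1 + a₁ * ℓ) * u + a₂ * s + a₃ * (L ^ ((1 + δ) / 2) * v) with hW
    have hB : 0 < L ^ ((1 + δ) / 2) * v := by positivity
    have hs : 0 ≤ a₂ * s := by positivity
    have e1 : ℓ * u ≤ 1 / a₁ * W := by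
      rw [one_div, ← div_eq_inv_mul, le_div_iff₀ h₁, hW]
      have := mul_pos h₃ hB
      nlinarith
    have e2 : ℓ ^ ((1 + δ) / 2) * v ≤ 1 / a₃ * W := by
      rw [one_div, ← div_eq_inv_mul, le_div_iff₀ h₃, hW]
      have e3 : ℓ ^ ((1 + δ) / 2) * v ≤ L ^ ((1 + δ) / 2) * v := by gcongr
      have : 0 < (1 + a₁ * ℓ) * u := by positivity
      nlinarith
    linarith

end MedianCI

theorem theorem3 {Ω : Type*} [MeasurableSpace Ω] (P : Measure Ω) [IsProbabilityMeasure P]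
    (ν : Measure ℝ) [IsProbabilityMeasure ν] (θ₀ M C δ η : ℝ)
    (hM : 0 < M) (hC : 0 < C) (hδ : 0 < δ) (hη : 0 < η)
    (hcont : Continuous (cdf ν)) (hmed : MedianCI.IsMedian ν θ₀)
    (hF : ∀ h : ℝ, |h| < η →
      |cdf ν (θ₀ + h) - cdf ν θ₀ - M * h| ≤ C * |h| ^ (1 + δ)) :
    (∀ n : ℕ, 2 ≤ n → ∀ α : ℝ, 0 < α → α < 1 →
      max (Real.logb 2 (2 / α))
        (49 * Real.log (2 * n / α) / MedianCI.zeta M C δ η ^ 2) ≤ (n : ℝ) →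
      ∀ X : Fin n → Ω → ℝ, (∀ i, HasLaw (X i) ν P) → iIndepFun X P →
        1 - 6 / (n : ℝ) ^ 2 ≤
          P.real {ω | Bornology.IsBounded (MedianCI.CI α (fun i => X i ω)) ∧
            |Real.sqrt n * M / MedianCI.z (α / 2)
                * MedianCI.width (MedianCI.CI α (fun i => X i ω)) - 1|
              ≤ MedianCI.bound M C δ α n}) ∧
    (∀ α : ℝ, 0 < α → α < 1 →
      (fun n : ℕ => MedianCI.bound M C δ α n) =Θ[atTop]
        (fun n : ℕ => Real.log n * (n : ℝ) ^ (-(1 / 4) : ℝ)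
          + Real.log n ^ ((1 + δ) / 2) * (n : ℝ) ^ (-(δ / 2)))) := by
  exact ⟨fun n hn α hα0 hα1 hmax X hX hind =>
    MedianCI.prob_width_bound hM hC hδ hη hcont hmed hF hn hα0 hα1
      ((le_max_left _ _).trans hmax) ((le_max_right _ _).trans hmax) hX hind,
    fun α hα0 hα1 => MedianCI.bound_isTheta hM hC hδ hα0 hα1⟩
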